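/- A \emph{path} is the graph of a continuous function $f\colon[0,1]\to\mathbb{R}$. A \emph{system} is a finite collection of at least three paths with distinct endpoints such that any two paths meet in finitely many points, any two paths cross at every point where they meet, and no three paths have a common point. A \emph{subsystem} of a system $S$ is a subset of $S$ with at least three paths, and $|S|$ denotes the number of paths. A system is \emph{$k$-crossing} if each pair of its paths crosses at least once and at most $k$ times. It is \emph{upper convex} if each of its paths lies, at some point of $[0,1]$, strictly above all other paths of the system. The \emph{signature} of a system of size $3$, with paths $1,2,3$ numbered from bottom to top by their left endpoints, is the word in $x,y,z$ that records its crossings from left to right, where $x$, $y$, $z$ stand for a crossing of the paths $\{1,2\}$, $\{1,3\}$, $\{2,3\}$, respectively. Let $M_k$ be the number of signatures of $k$-crossing systems of size $3$ (it is finite). Let $R_3(n;M)$ be the least integer such that, for every $N\ge R_3(n;M)$ and every partition of the $3$-element subsets of $\{1,\dots,N\}$ into at most $M$ classes, there is a set $A\subseteq\{1,\dots,N\}$ with $|A|\ge n$ all of whose $3$-element subsets lie in the same class. \textbf{Theorem.} For any integers $k\ge 1$ and $n\ge 3$ there exists a minimal positive integer $U_k(n)$ such that the following holds for every $k$-crossing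 system $S$ of size at least $U_k(n)$: \begin{enumerate} \item if $k\le 2$ and every subsystem of $S$ of size $3$ is upper convex, then $S$ contains an upper convex subsystem of size $n$; \item if $k\le 4$ and every subsystem of $S$ of size $4$ is upper convex, then $S$ contains an upper convex subsystem of size $n$; \item if $k\ge 5$ and every subsystem of $S$ of size $5$ is upper convex, then $S$ contains an upper convex subsystem of size $n$. \end{enumerate} Moreover, the number $R_3(n;M_k)$ exists, $U_k(n)\le R_3(n;M_k)$ for all $n\ge 4$, and $U_k(3)\le 5$. -/

import Mathlib

open Topology

namespace PathSystem

/-- A path: (the graph of) a continuous function `[0,1] → ℝ`. -/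
abbrev Path01 : Type := C(unitInterval, ℝ)

/-- The set of abscissae at which two paths intersect. -/
def meet (f g : Path01) : Set unitInterval := {t | f t = g t}

/-- The paths `f` and `g` change their vertical order at `t`. -/
def CrossAt (f g : Path01) (t : unitInterval) : Prop :=
  ((∀ᶠ s in 𝓝[<] t, f s < g s) ∧ (∀ᶠ s in 𝓝[>] t, g s < f s)) ∨
  ((∀ᶠ s in 𝓝[<] t, g s < f s) ∧ (∀ᶠ s in 𝓝[>] t, f s < g s))

/-- A system of paths: at least three paths with distinct endpoints, finite pairwise
intersections, a crossing at every intersection point, and no triple intersections. -/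
structure IsSystem (S : Finset Path01) : Prop where
  three_le_card : 3 ≤ S.card
  left_ne : ∀ f ∈ S, ∀ g ∈ S, f ≠ g → f 0 ≠ g 0
  right_ne : ∀ f ∈ S, ∀ g ∈ S, f ≠ g → f 1 ≠ g 1
  finite_meet : ∀ f ∈ S, ∀ g ∈ S, f ≠ g → (meet f g).Finite
  crossAt : ∀ f ∈ S, ∀ g ∈ S, f ≠ g → ∀ t ∈ meet f g, CrossAt f g t
  no_triple : ∀ f ∈ S, ∀ g ∈ S, ∀ h ∈ S, f ≠ g → f ≠ h → g ≠ h →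
    ∀ t, ¬ (f t = g t ∧ g t = h t)

/-- Each pair of paths of `S` crosses at least once and at most `k` times. -/
def IsCrossing (k : ℕ) (S : Finset Path01) : Prop :=
  ∀ f ∈ S, ∀ g ∈ S, f ≠ g → 1 ≤ (meet f g).ncard ∧ (meet f g).ncard ≤ k

/-- At some abscissa the path `f` is strictly above every other path of `S`. -/
def OnUpperEnvelope (S : Finset Path01) (f : Path01) : Prop :=
  ∃ t, ∀ g ∈ S, g ≠ f → g t < f t

/-- All paths of `S` appear on the upper envelope of `S`. -/
def UpperConvex (S : Finset Path01) : Prop :=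
  ∀ f ∈ S, OnUpperEnvelope S f

/-- Every subsystem of `S` of size `m` is upper convex. -/
def EverySubUpperConvex (m : ℕ) (S : Finset Path01) : Prop :=
  ∀ T ⊆ S, T.card = m → UpperConvex T

/-- `S` contains an upper convex subsystem of size `m`. -/
def HasUpperConvexSub (m : ℕ) (S : Finset Path01) : Prop :=
  ∃ T ⊆ S, T.card = m ∧ UpperConvex T

/-- The three implications hold for every `k`-crossing system of size at least `U`. -/
def OneSided (k n U : ℕ) : Prop :=
  ∀ S : Finset Path01, IsSystem S → IsCrossing k S → U ≤ S.card →
    (k ≤ 2 → EverySubUpperConvex 3 S → HasUpperConvexSub n S) ∧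
    (k ≤ 4 → EverySubUpperConvex 4 S → HasUpperConvexSub n S) ∧
    (5 ≤ k → EverySubUpperConvex 5 S → HasUpperConvexSub n S)

/-- The letters of signatures. -/
inductive Letter : Type
  | x
  | y
  | z

/-- The intersections recorded by a letter, for three paths listed from bottom to top
according to their left endpoints. -/
def letterMeet (f₁ f₂ f₃ : Path01) : Letter → Set unitInterval
  | Letter.x => meet f₁ f₂
  | Letter.y => meet f₁ f₃
  | Letter.z => meet f₂ f₃

/-- The word `w` is the signature of the three-path system `S`: it records the crossings of `S`
from left to right, occurring at the abscissae `τ 0 < τ 1 < ⋯`. -/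
def HasSignature (S : Finset Path01) (w : List Letter) : Prop :=
  ∃ f₁ f₂ f₃ : Path01, (S : Set Path01) = {f₁, f₂, f₃} ∧ f₁ 0 < f₂ 0 ∧ f₂ 0 < f₃ 0 ∧
    ∃ τ : Fin w.length → unitInterval, StrictMono τ ∧
      ∀ (l : Letter) (t : unitInterval), t ∈ letterMeet f₁ f₂ f₃ l ↔ ∃ i, τ i = t ∧ w.get i = l

/-- The set of all signatures of `k`-crossing systems of size 3. -/
def signatures (k : ℕ) : Set (List Letter) :=
  {w | ∃ S : Finset Path01, IsSystem S ∧ S.card = 3 ∧ IsCrossing k S ∧ HasSignature S w}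

/-- For every `N ≥ R`, every partition of the triples of an `N`-element set into at most `M`
classes admits a set of at least `n` elements all of whose triples are in the same class. -/
def RamseyTriples (n M R : ℕ) : Prop :=
  ∀ N, R ≤ N → ∀ c : {T : Finset (Fin N) // T.card = 3} → Fin M,
    ∃ A : Finset (Fin N), n ≤ A.card ∧
      ∃ j : Fin M, ∀ T : {T : Finset (Fin N) // T.card = 3}, T.1 ⊆ A → c T = j

end PathSystem

/-!
Order the paths of a system by their left endpoints and colour each triple by its signature. There
are finitely many signatures (`finite_signatures`), so by Ramsey's theorem for triples
(`exists_ramseyTriples`) a large system contains `n` paths whose triples all have the same signature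
(`exists_uniform`). Such a uniform list of paths is itself upper convex, provided that all small
subsystems are.

To see this, let `m` be the common number of crossings of the pairs. The crossings of the paths `p`
and `q` divide `[0, 1]` into `m + 1` intervals, numbered from `0`. If `p` starts below `q`, then `p`
is above `q` exactly in the intervals with odd number, otherwise exactly in those with even number
(`lt_of_nthPoint`). Since whether two such intervals of two pairs in a triple intersect depends only
on the signature, intervals which intersect in one triple intersect in all of them. Hence it is
enough to find an odd `i` and an even `l` such that, for paths `1`, `2`, `3` of any triple in this
order,

* the intervals number `i` of `{1, 2}` and `{1, 3}` intersect,
* the intervals number `l` of `{1, 3}` and `{2, 3}` intersect,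
* the interval number `l` of `{1, 2}` and the interval number `i` of `{2, 3}` intersect.

Then, for a fixed path `p`, the intervals number `i` of the pairs `{p, q}` with `q` after `p` and
the intervals number `l` of those with `q` before `p` intersect pairwise, and by Helly's theorem on
the line they have a common point, where `p` is above all other paths
(`RegularFamily.exists_aboveAt`).

The numbers `i` and `l` come from the small upper convex subsystems. A point where a path is above
two paths before it and two paths after it provides two odd and two even numbers; one number of each
kind can be used twice, by `RegularFamily.false_of_disjoint`. This settles subsystems of size five
(`RegularFamily.exists_overlap_of_four`). With size four, one gets a pair `(i, l)` with the first
and third property and another pair with the second and third one. For `m ≤ 4` the first and the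
last intervals, which intersect for trivial reasons, leave few cases in which neither pair nor a
combination of them will do, and these contradict the regularity of five paths
(`RegularFamily.exists_overlap_of_three`). With size three and `m ≤ 2` there is just one odd number,
and all even numbers have the second property (`RegularFamily.exists_overlap_of_two`).

For `k ≥ 5` and `n = 4` the hypothesis on subsystems of size five is void unless the system has five
paths. The bound by the Ramsey number holds there as well because at least two signatures occur
(`two_le_ncard_signatures`), so that this Ramsey number is at least five.
-/

namespace PathSystem

/-! ### Ramsey's theorem for triples -/

/-- A map from a type with an ultrafilter to a finite type is constant on a large set. -/
lemma exists_eventually_eq {ι κ : Type*} [Finite κ] (U : Ultrafilter ι) (f : ι → κ) :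
    ∃ j, ∀ᶠ d in (U : Filter ι), f d = j := by
  by_contra! h
  have h' : ∀ᶠ d in (U : Filter ι), ∀ j, f d ≠ j :=
    Filter.eventually_all.2 fun j => Ultrafilter.eventually_not.2 (by simpa using h j)
  obtain ⟨d, hd⟩ := h'.exists
  exact hd _ rfl

lemma exists_lt_lt_of_card_eq_three {V : Type*} [LinearOrder V] {T : Finset V}
    (hT : T.card = 3) : ∃ a b d, a < b ∧ b < d ∧ T = {a, b, d} := by
  refine ⟨T.orderEmbOfFin hT 0, T.orderEmbOfFin hT 1, T.orderEmbOfFin hT 2, by simp, by simp, ?_⟩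
  have h := Finset.image_orderEmbOfFin_univ T hT
  ext v
  have hv : v ∈ Finset.image (⇑(T.orderEmbOfFin hT)) Finset.univ ↔ v ∈ T := by rw [h]
  rw [← hv]
  simp only [Finset.mem_image, Finset.mem_univ, true_and, Fin.exists_fin_succ, Finset.mem_insert,
    Finset.mem_singleton, eq_comm (a := v)]
  simp

/-- Any sequence of colourings of the triples of `ℕ` has an ultralimit, and an ultralimit of the
limit colouring in each of its variables in turn yields, greedily, a homogeneous set; on this set
almost all members of the sequence are constant. -/
lemma exists_homogeneous_of_sequence {κ : Type*} [Finite κ] (n : ℕ)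
    (g : ℕ → ℕ → ℕ → ℕ → κ) :
    ∃ (A : Finset ℕ) (j : κ), A.card = n ∧ ∀ᶠ R in (Filter.hyperfilter ℕ : Filter ℕ),
      ∀ a ∈ A, ∀ b ∈ A, ∀ d ∈ A, a < b → b < d → g R a b d = j := by
  choose χ₃ h₃ using fun a b d => exists_eventually_eq (Filter.hyperfilter ℕ) fun R => g R a b d
  choose χ₂ h₂ using fun a b => exists_eventually_eq (Filter.hyperfilter ℕ) fun d => χ₃ a b d
  choose χ₁ h₁ using fun a => exists_eventually_eq (Filter.hyperfilter ℕ) fun b => χ₂ a b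
  obtain ⟨j, h₀⟩ := exists_eventually_eq (Filter.hyperfilter ℕ) χ₁
  have key : ∃ A : Finset ℕ, A.card = n ∧ (∀ a ∈ A, χ₁ a = j) ∧
      (∀ a ∈ A, ∀ b ∈ A, a < b → χ₂ a b = j) ∧
      (∀ a ∈ A, ∀ b ∈ A, ∀ d ∈ A, a < b → b < d → χ₃ a b d = j) := by
    induction n with
    | zero => exact ⟨∅, by simp⟩
    | succ n ih =>
      obtain ⟨A, hA, i₁, i₂, i₃⟩ := ih
      have e₁ : ∀ᶠ x in (Filter.hyperfilter ℕ : Filter ℕ), ∀ a ∈ A, a < x :=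
        (Finset.eventually_all A).2 fun a _ =>
          (Nat.hyperfilter_le_atTop) (Filter.eventually_gt_atTop a)
      have e₂ : ∀ᶠ x in (Filter.hyperfilter ℕ : Filter ℕ), ∀ a ∈ A, χ₂ a x = j :=
        (Finset.eventually_all A).2 fun a ha => by
          have := h₁ a
          rwa [i₁ a ha] at this
      have e₃ : ∀ᶠ x in (Filter.hyperfilter ℕ : Filter ℕ), ∀ a ∈ A, ∀ b ∈ A, a < b →
          χ₃ a b x = j :=
        (Finset.eventually_all A).2 fun a ha => (Finset.eventually_all A).2 fun b hb => by
          by_cases hab : a < b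
          · have := h₂ a b
            rw [i₂ a ha b hb hab] at this
            filter_upwards [this] with x hx _ using hx
          · exact Filter.Eventually.of_forall fun x h => absurd h hab
      obtain ⟨x, x₀, x₁, x₂, x₃⟩ := (h₀.and (e₁.and (e₂.and e₃))).exists
      have hx : x ∉ A := fun h => (x₁ x h).false
      refine ⟨insert x A, by simp [hx, hA], ?_, ?_, ?_⟩
      · simpa using ⟨x₀, i₁⟩
      · intro a ha b hb hab
        rcases Finset.mem_insert.1 ha with rfl | ha <;> rcases Finset.mem_insert.1 hb with rfl | hb
        · exact absurd hab (lt_irrefl _)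
        · exact absurd hab (x₁ b hb).not_gt
        · exact x₂ a ‹_›
        · exact i₂ a ha b hb hab
      · intro a ha b hb d hd hab hbd
        have hb' : b ∈ A := by
          rcases Finset.mem_insert.1 hb with rfl | hb
          · rcases Finset.mem_insert.1 hd with rfl | hd
            · exact absurd hbd (lt_irrefl _)
            · exact absurd hbd (x₁ d hd).not_gt
          · exact hb
        have ha' : a ∈ A := by
          rcases Finset.mem_insert.1 ha with rfl | ha
          · exact absurd hab (x₁ b hb').not_gt
          · exact ha
        rcases Finset.mem_insert.1 hd with rfl | hd
        · exact x₃ a ha' b hb' hab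
        · exact i₃ a ha' b hb' d hd hab hbd
  obtain ⟨A, hA, -, -, i₃⟩ := key
  refine ⟨A, j, hA, ?_⟩
  refine (Finset.eventually_all A).2 fun a ha => (Finset.eventually_all A).2 fun b hb =>
    (Finset.eventually_all A).2 fun d hd => ?_
  by_cases h : a < b ∧ b < d
  · have := h₃ a b d
    rw [i₃ a ha b hb d hd h.1 h.2] at this
    filter_upwards [this] with R hR _ _ using hR
  · exact Filter.Eventually.of_forall fun R h₁ h₂ => absurd ⟨h₁, h₂⟩ h

/-- Finite Ramsey theorem for triples, by compactness: colourings without large homogeneous sets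
on arbitrarily large ground sets would contradict `exists_homogeneous_of_sequence`. -/
theorem exists_ramseyTriples (n M : ℕ) : ∃ R, RamseyTriples n M R := by
  by_contra! H
  simp only [RamseyTriples] at H
  push Not at H
  choose N hN c hc using H
  rcases Nat.eq_zero_or_pos M with rfl | hM
  · obtain ⟨T, -, hT⟩ := Finset.exists_subset_card_eq
      (s := (Finset.univ : Finset (Fin (N 3)))) (n := 3) (by simpa using hN 3)
    exact (c 3 ⟨T, hT⟩).elim0
  have card3 : ∀ {V : Type} [LinearOrder V] {a b d : V}, a < b → b < d →
      ({a, b, d} : Finset V).card = 3 := fun {V} _ {a b d} hab hbd =>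
    Finset.card_eq_three.2 ⟨a, b, d, hab.ne, (hab.trans hbd).ne, hbd.ne, rfl⟩
  let g : ℕ → ℕ → ℕ → ℕ → Fin M := fun R a b d =>
    if h : a < b ∧ b < d ∧ d < N R then
      c R ⟨{⟨a, h.1.trans (h.2.1.trans h.2.2)⟩, ⟨b, h.2.1.trans h.2.2⟩, ⟨d, h.2.2⟩},
        card3 h.1 h.2.1⟩
    else ⟨0, hM⟩
  obtain ⟨A, j, hA, hj⟩ := exists_homogeneous_of_sequence n g
  have hlt : ∀ᶠ R in (Filter.hyperfilter ℕ : Filter ℕ), ∀ a ∈ A, a < R :=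
    (Finset.eventually_all A).2 fun a _ =>
      (Nat.hyperfilter_le_atTop) (Filter.eventually_gt_atTop a)
  obtain ⟨R, hR, hR'⟩ := (hj.and hlt).exists
  have hltN : ∀ a ∈ A, a < N R := fun a ha => (hR' a ha).trans_le (hN R)
  have hcard : n ≤ (A.attachFin hltN).card := by simp [hA]
  obtain ⟨T, hT, hne⟩ := hc R (A.attachFin hltN) hcard j
  apply hne
  obtain ⟨a, b, d, hab, hbd, hTe⟩ := exists_lt_lt_of_card_eq_three T.2
  have ha : (a : ℕ) ∈ A := Finset.mem_attachFin hltN |>.1 (hT (by simp [hTe]))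
  have hb : (b : ℕ) ∈ A := Finset.mem_attachFin hltN |>.1 (hT (by simp [hTe]))
  have hd : (d : ℕ) ∈ A := Finset.mem_attachFin hltN |>.1 (hT (by simp [hTe]))
  have := hR a ha b hb d hd hab hbd
  rw [← this]
  simp only [g]
  rw [dif_pos ⟨hab, hbd, d.2⟩]
  congr 1
  exact Subtype.ext hTe

/-! ### Regular families of crossing sequences -/

/-- For indices `a < b < d`, the sequence attached to the pair which a letter stands for. -/
def letterSeq {V : Type*} (c : V → V → ℕ → ℝ) (a b d : V) : Letter → ℕ → ℝ
  | Letter.x => c a b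
  | Letter.y => c a d
  | Letter.z => c b d

/-- The combinatorial content of a system all of whose triples have the same signature. The number
`c a b i`, for `1 ≤ i ≤ m`, is the abscissa of the `i`-th crossing of the paths `a` and `b`; the
conventions `c a b 0 = -1` and `c a b (m + 1) = 2` make the `m + 1` intervals between crossings
uniform. Indices are ordered as the left endpoints of the paths. -/
structure RegularFamily {V : Type*} [LinearOrder V] (m : ℕ) (c : V → V → ℕ → ℝ) : Prop where
  symm : ∀ a b, c a b = c b a
  zero : ∀ a b, a ≠ b → c a b 0 = -1
  last : ∀ a b, a ≠ b → c a b (m + 1) = 2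
  lt_succ : ∀ a b, a ≠ b → ∀ i ≤ m, c a b i < c a b (i + 1)
  mem_Ioo : ∀ a b, a ≠ b → ∀ i, 1 ≤ i → i ≤ m → c a b i ∈ Set.Ioo (0 : ℝ) 1
  regular : ∀ a b d a' b' d', a < b → b < d → a' < b' → b' < d' → ∀ l l' i j,
    letterSeq c a b d l i < letterSeq c a b d l' j →
      letterSeq c a' b' d' l i < letterSeq c a' b' d' l' j
  ne : ∀ a b d, a < b → b < d → ∀ l l', l ≠ l' → ∀ i j, 1 ≤ i → i ≤ m → 1 ≤ j → j ≤ m →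
    letterSeq c a b d l i ≠ letterSeq c a b d l' j

/-- The open interval number `i` of the pair `l` and the open interval number `j` of the pair `l'`
intersect, in every triple. -/
def Overlap {V : Type*} [LinearOrder V] (c : V → V → ℕ → ℝ) (l : Letter) (i : ℕ) (l' : Letter)
    (j : ℕ) : Prop :=
  ∀ a b d, a < b → b < d → letterSeq c a b d l i < letterSeq c a b d l' (j + 1) ∧
    letterSeq c a b d l' j < letterSeq c a b d l (i + 1)

/-- At `t`, the path `p` lies above the path `q`: this is so in the intervals with odd number
if `p` starts below `q`, and in those with even number otherwise. -/
def AboveAt {V : Type*} [LinearOrder V] (m : ℕ) (c : V → V → ℕ → ℝ) (p q : V) (t : ℝ) : Prop :=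
  ∃ i ≤ m, (p < q → Odd i) ∧ (q < p → Even i) ∧ c p q i < t ∧ t < c p q (i + 1)

namespace RegularFamily

variable {V : Type*} [LinearOrder V] {m : ℕ} {c : V → V → ℕ → ℝ}

/-- By regularity, one common point in one triple gives `Overlap`. -/
lemma overlap_of_mem (hc : RegularFamily m c) {a b d : V} (hab : a < b) (hbd : b < d)
    {l l' : Letter} {i j : ℕ} {t : ℝ}
    (h₁ : letterSeq c a b d l i < t) (h₂ : t < letterSeq c a b d l (i + 1))
    (h₃ : letterSeq c a b d l' j < t) (h₄ : t < letterSeq c a b d l' (j + 1)) :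
    Overlap c l i l' j := fun _ _ _ h h' =>
  ⟨hc.regular _ _ _ _ _ _ hab hbd h h' _ _ _ _ (h₁.trans h₄),
    hc.regular _ _ _ _ _ _ hab hbd h h' _ _ _ _ (h₃.trans h₂)⟩

/-- If two intervals do not overlap then they are disjoint in the same order in all triples. -/
lemma disjoint_of_not_overlap (hc : RegularFamily m c) {l l' : Letter} {i j : ℕ}
    (h : ¬ Overlap c l i l' j) :
    (∀ a b d, a < b → b < d → letterSeq c a b d l' (j + 1) ≤ letterSeq c a b d l i) ∨
    (∀ a b d, a < b → b < d → letterSeq c a b d l (i + 1) ≤ letterSeq c a b d l' j) := by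
  by_contra! H
  obtain ⟨⟨a, b, d, hab, hbd, h₁⟩, ⟨a', b', d', hab', hbd', h₂⟩⟩ := H
  exact h fun u v w huv hvw => ⟨hc.regular _ _ _ _ _ _ hab hbd huv hvw _ _ _ _ h₁,
    hc.regular _ _ _ _ _ _ hab' hbd' huv hvw _ _ _ _ h₂⟩

lemma lt_of_lt (hc : RegularFamily m c) {a b : V} (hab : a ≠ b) {i j : ℕ} (hij : i < j)
    (hj : j ≤ m + 1) : c a b i < c a b j := by
  induction j, hij using Nat.le_induction with
  | base => exact hc.lt_succ a b hab i (by omega)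
  | succ j hij ih => exact (ih (by omega)).trans (hc.lt_succ a b hab j (by omega))

lemma lt_one (hc : RegularFamily m c) {a b : V} (hab : a ≠ b) {i : ℕ} (hi : i ≤ m) :
    c a b i < 1 := by
  rcases Nat.eq_zero_or_pos i with rfl | h
  · rw [hc.zero a b hab]; norm_num
  · exact (hc.mem_Ioo a b hab i h hi).2

lemma pos (hc : RegularFamily m c) {a b : V} (hab : a ≠ b) {i : ℕ} (hi : i ≤ m) :
    0 < c a b (i + 1) := by
  rcases hi.eq_or_lt with rfl | h
  · rw [hc.last a b hab]; norm_num
  · exact (hc.mem_Ioo a b hab (i + 1) (by omega) h).1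

lemma letterSeq_lt_one (hc : RegularFamily m c) {a b d : V} (hab : a < b) (hbd : b < d)
    (l : Letter) {i : ℕ} (hi : i ≤ m) : letterSeq c a b d l i < 1 := by
  cases l
  exacts [hc.lt_one hab.ne hi, hc.lt_one (hab.trans hbd).ne hi, hc.lt_one hbd.ne hi]

lemma letterSeq_pos (hc : RegularFamily m c) {a b d : V} (hab : a < b) (hbd : b < d)
    (l : Letter) {i : ℕ} (hi : i ≤ m) : 0 < letterSeq c a b d l (i + 1) := by
  cases l
  exacts [hc.pos hab.ne hi, hc.pos (hab.trans hbd).ne hi, hc.pos hbd.ne hi]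

lemma letterSeq_zero (hc : RegularFamily m c) {a b d : V} (hab : a < b) (hbd : b < d)
    (l : Letter) : letterSeq c a b d l 0 = -1 := by
  cases l
  exacts [hc.zero _ _ hab.ne, hc.zero _ _ (hab.trans hbd).ne, hc.zero _ _ hbd.ne]

lemma letterSeq_last (hc : RegularFamily m c) {a b d : V} (hab : a < b) (hbd : b < d)
    (l : Letter) : letterSeq c a b d l (m + 1) = 2 := by
  cases l
  exacts [hc.last _ _ hab.ne, hc.last _ _ (hab.trans hbd).ne, hc.last _ _ hbd.ne]

/-- First intervals all contain the left end. -/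
lemma overlap_zero (hc : RegularFamily m c) (l l' : Letter) : Overlap c l 0 l' 0 :=
  fun a b d hab hbd => by
    have h₁ := hc.letterSeq_pos hab hbd l (Nat.zero_le m)
    have h₂ := hc.letterSeq_pos hab hbd l' (Nat.zero_le m)
    rw [hc.letterSeq_zero hab hbd, hc.letterSeq_zero hab hbd]
    constructor <;> linarith

/-- Last intervals all contain the right end. -/
lemma overlap_last (hc : RegularFamily m c) (l l' : Letter) : Overlap c l m l' m :=
  fun a b d hab hbd => by
    have h₁ := hc.letterSeq_lt_one hab hbd l le_rfl
    have h₂ := hc.letterSeq_lt_one hab hbd l' le_rfl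
    rw [hc.letterSeq_last hab hbd, hc.letterSeq_last hab hbd]
    constructor <;> linarith

/-- One-dimensional Helly argument: pairwise overlapping intervals, one for each `q ≠ p`, have a
common point, and `p` is above all `q` there. -/
lemma exists_aboveAt [Finite V] [Nontrivial V] (hc : RegularFamily m c) {i l : ℕ}
    (hi : Odd i) (him : i ≤ m) (hl : Even l) (hlm : l ≤ m)
    (hA : Overlap c Letter.x i Letter.y i) (hB : Overlap c Letter.y l Letter.z l)
    (hAB : Overlap c Letter.x l Letter.z i) (p : V) :
    ∃ t ∈ Set.Icc (0 : ℝ) 1, ∀ q, q ≠ p → AboveAt m c p q t := by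
  classical
  cases nonempty_fintype V
  let r : V → ℕ := fun q => if p < q then i else l
  have hr : ∀ q, r q ≤ m := fun q => by simp only [r]; split_ifs <;> assumption
  have pair : ∀ q q', q ≠ p → q' ≠ p → c p q (r q) < c p q' (r q' + 1) := by
    intro q q' hq hq'
    rcases eq_or_ne q q' with rfl | hqq
    · exact hc.lt_succ p q hq.symm _ (hr q)
    rcases lt_or_gt_of_ne hq with h | h <;> rcases lt_or_gt_of_ne hq' with h' | h'
    · simp only [r, if_neg h.not_gt, if_neg h'.not_gt]
      rw [hc.symm p q, hc.symm p q']
      rcases lt_or_gt_of_ne hqq with hl | hl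
      · exact (hB q q' p hl h').1
      · exact (hB q' q p hl h).2
    · simp only [r, if_neg h.not_gt, if_pos h']
      rw [hc.symm p q]
      exact (hAB q p q' h h').1
    · simp only [r, if_pos h, if_neg h'.not_gt]
      rw [hc.symm p q']
      exact (hAB q' p q h' h).2
    · simp only [r, if_pos h, if_pos h']
      rcases lt_or_gt_of_ne hqq with hl | hl
      · exact (hA p q q' h hl).1
      · exact (hA p q' q h' hl).2
  obtain ⟨q₀, hq₀⟩ := exists_ne p
  have hne : (Finset.univ.filter fun q : V => q ≠ p).Nonempty := ⟨q₀, by simpa using hq₀⟩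
  obtain ⟨u, hu, hu'⟩ := Finset.exists_max_image _ (fun q => c p q (r q)) hne
  obtain ⟨v, hv, hv'⟩ := Finset.exists_min_image _ (fun q => c p q (r q + 1)) hne
  simp only [Finset.mem_filter, Finset.mem_univ, true_and] at hu hu' hv hv'
  have h₁ := pair u v hu hv
  have h₂ := hc.lt_one hu.symm (hr u)
  have h₃ := hc.pos hv.symm (hr v)
  obtain ⟨t, ht, ht'⟩ : ∃ t, max (c p u (r u)) 0 < t ∧ t < min (c p v (r v + 1)) 1 :=
    exists_between (by simp [h₁, h₂, h₃])
  simp only [max_lt_iff, lt_min_iff] at ht ht'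
  refine ⟨t, ⟨ht.2.le, ht'.2.le⟩, fun q hq => ⟨r q, hr q, fun h => ?_, fun h => ?_,
    (hu' q hq).trans_lt ht.1, ht'.1.trans_le (hv' q hq)⟩⟩
  · simpa [r, h] using hi
  · simpa [r, h.not_gt] using hl

/-! ### Overlapping intervals -/

/-- Consider four increasing sequences `u₁, …, u₄`. If for `a < b` the interval number `i` of `u a`
always meets the interval number `j` of `u b`, then it cannot be that both the intervals number `i`
are disjoint, in one and the same order, and the intervals number `j` are. Indeed, if, say, `i < j`,
then both sequences of intervals must move to the left; the fourth interval number `j` then covers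
the second interval number `i`, and separates it from the third interval number `j`. -/
lemma false_of_disjoint {u₁ u₂ u₃ u₄ : ℕ → ℝ} {i j : ℕ}
    (hi : ∀ u ∈ [u₁, u₂, u₃, u₄], u i < u (i + 1))
    (hj : ∀ u ∈ [u₁, u₂, u₃, u₄], u j < u (j + 1))
    (hij : i ≠ j) (hlt : ∀ u ∈ [u₁, u₂, u₃, u₄], i < j → u (i + 1) ≤ u j)
    (hgt : ∀ u ∈ [u₁, u₂, u₃, u₄], j < i → u (j + 1) ≤ u i)
    (hm : [u₁, u₂, u₃, u₄].Pairwise fun u v => u i < v (j + 1) ∧ v j < u (i + 1))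
    (di : ([u₁, u₂, u₃, u₄].Pairwise fun u v => v (i + 1) ≤ u i) ∨
      [u₁, u₂, u₃, u₄].Pairwise fun u v => u (i + 1) ≤ v i)
    (dj : ([u₁, u₂, u₃, u₄].Pairwise fun u v => v (j + 1) ≤ u j) ∨
      [u₁, u₂, u₃, u₄].Pairwise fun u v => u (j + 1) ≤ v j) : False := by
  simp only [List.mem_cons, List.not_mem_nil, or_false, forall_eq_or_imp, forall_eq,
    List.pairwise_cons, List.Pairwise.nil, and_true] at *
  rcases lt_or_gt_of_ne hij with h | h
  · simp only [h, forall_const] at hlt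
    rcases di with di | di <;> rcases dj with dj | dj <;> grind
  · simp only [h, forall_const] at hgt
    rcases di with di | di <;> rcases dj with dj | dj <;> grind

/-- If the pairs `l`, `l'` of suitable triples run through all pairs of four crossing sequences, then
of two intervals overlapping for `l` and `l'`, one may be used for both. -/
lemma overlap_self_or_overlap_self (hc : RegularFamily m c) {l l' : Letter} {u₁ u₂ u₃ u₄ : ℕ → ℝ}
    (hmono : ∀ u ∈ [u₁, u₂, u₃, u₄], ∃ a b, a ≠ b ∧ u = c a b)
    (pw : ∀ R : (ℕ → ℝ) → (ℕ → ℝ) → Prop,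
      (∀ a b d, a < b → b < d → R (letterSeq c a b d l) (letterSeq c a b d l')) →
      [u₁, u₂, u₃, u₄].Pairwise R)
    {i j : ℕ} (hi : i ≤ m) (hj : j ≤ m) (h : Overlap c l i l' j) :
    Overlap c l i l' i ∨ Overlap c l j l' j := by
  by_contra! H
  obtain ⟨Hi, Hj⟩ := H
  have hij : i ≠ j := by rintro rfl; exact Hi h
  have hlt : ∀ u ∈ [u₁, u₂, u₃, u₄], ∀ r s, r < s → s ≤ m + 1 → u r < u s := by
    intro u hu r s hrs hs
    obtain ⟨a, b, hab, rfl⟩ := hmono u hu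
    exact hc.lt_of_lt hab hrs hs
  have hle : ∀ u ∈ [u₁, u₂, u₃, u₄], ∀ r s, r < s → s ≤ m → u (r + 1) ≤ u s := by
    intro u hu r s hrs hs
    rcases (Nat.succ_le_of_lt hrs).eq_or_lt with e | e
    exacts [e ▸ le_rfl, (hlt u hu _ _ e (by omega)).le]
  exact false_of_disjoint (fun u hu => hlt u hu _ _ (Nat.lt_succ_self i) (by omega))
    (fun u hu => hlt u hu _ _ (Nat.lt_succ_self j) (by omega)) hij
    (fun u hu h => hle u hu _ _ h hj) (fun u hu h => hle u hu _ _ h hi)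
    (pw _ h) ((hc.disjoint_of_not_overlap Hi).imp (pw _) (pw _))
    ((hc.disjoint_of_not_overlap Hj).imp (pw _) (pw _))

/-- Two intervals overlapping for `x` and `y`: look at the pairs of the lowest of five paths. -/
lemma overlap_xy (hc : RegularFamily m c) {v₀ v₁ v₂ v₃ v₄ : V} (h₀ : v₀ < v₁) (h₁ : v₁ < v₂)
    (h₂ : v₂ < v₃) (h₃ : v₃ < v₄) {i j : ℕ} (hi : i ≤ m) (hj : j ≤ m)
    (h : Overlap c Letter.x i Letter.y j) :
    Overlap c Letter.x i Letter.y i ∨ Overlap c Letter.x j Letter.y j := by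
  have n₂ := h₀.trans h₁
  have n₃ := n₂.trans h₂
  refine hc.overlap_self_or_overlap_self (u₁ := c v₀ v₁) (u₂ := c v₀ v₂) (u₃ := c v₀ v₃)
    (u₄ := c v₀ v₄) (fun u hu => ?_) (fun R hR => ?_) hi hj h
  · simp only [List.mem_cons, List.not_mem_nil, or_false] at hu
    rcases hu with rfl | rfl | rfl | rfl
    exacts [⟨_, _, h₀.ne, rfl⟩, ⟨_, _, n₂.ne, rfl⟩, ⟨_, _, n₃.ne, rfl⟩,
      ⟨_, _, (n₃.trans h₃).ne, rfl⟩]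
  · simp only [List.mem_cons, List.not_mem_nil, or_false, forall_eq_or_imp, forall_eq,
      List.pairwise_cons, List.Pairwise.nil, and_true]
    exact ⟨⟨hR _ _ _ h₀ h₁, hR _ _ _ h₀ (h₁.trans h₂), hR _ _ _ h₀ ((h₁.trans h₂).trans h₃)⟩,
      ⟨hR _ _ _ n₂ h₂, hR _ _ _ n₂ (h₂.trans h₃)⟩, hR _ _ _ n₃ h₃, by simp⟩

/-- Two intervals overlapping for `y` and `z`: look at the pairs of the highest of five paths. -/
lemma overlap_yz (hc : RegularFamily m c) {v₀ v₁ v₂ v₃ v₄ : V} (h₀ : v₀ < v₁) (h₁ : v₁ < v₂)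
    (h₂ : v₂ < v₃) (h₃ : v₃ < v₄) {i j : ℕ} (hi : i ≤ m) (hj : j ≤ m)
    (h : Overlap c Letter.y i Letter.z j) :
    Overlap c Letter.y i Letter.z i ∨ Overlap c Letter.y j Letter.z j := by
  have n₂ := h₂.trans h₃
  have n₁ := h₁.trans n₂
  refine hc.overlap_self_or_overlap_self (u₁ := c v₀ v₄) (u₂ := c v₁ v₄) (u₃ := c v₂ v₄)
    (u₄ := c v₃ v₄) (fun u hu => ?_) (fun R hR => ?_) hi hj h
  · simp only [List.mem_cons, List.not_mem_nil, or_false] at hu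
    rcases hu with rfl | rfl | rfl | rfl
    exacts [⟨_, _, (h₀.trans n₁).ne, rfl⟩, ⟨_, _, n₁.ne, rfl⟩, ⟨_, _, n₂.ne, rfl⟩,
      ⟨_, _, h₃.ne, rfl⟩]
  · simp only [List.mem_cons, List.not_mem_nil, or_false, forall_eq_or_imp, forall_eq,
      List.pairwise_cons, List.Pairwise.nil, and_true]
    exact ⟨⟨hR _ _ _ h₀ n₁, hR _ _ _ (h₀.trans h₁) n₂, hR _ _ _ ((h₀.trans h₁).trans h₂) h₃⟩,
      ⟨hR _ _ _ h₁ n₂, hR _ _ _ (h₁.trans h₂) h₃⟩, hR _ _ _ h₂ h₃, by simp⟩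

/-- `disjoint_of_not_overlap` with strict inequalities, which hold since different pairs of a triple
do not cross at the same point. -/
lemma disjoint_of_not_overlap_of_lt (hc : RegularFamily m c) {l l' : Letter} (hl : l ≠ l')
    {i j : ℕ} (hi : 1 ≤ i) (hi' : i < m) (hj : 1 ≤ j) (hj' : j < m) (h : ¬ Overlap c l i l' j) :
    (∀ a b d, a < b → b < d → letterSeq c a b d l' (j + 1) < letterSeq c a b d l i) ∨
    (∀ a b d, a < b → b < d → letterSeq c a b d l (i + 1) < letterSeq c a b d l' j) := by
  refine (hc.disjoint_of_not_overlap h).imp (fun H a b d hab hbd => ?_) fun H a b d hab hbd => ?_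
  · exact (H a b d hab hbd).lt_of_ne
      (hc.ne a b d hab hbd l' l hl.symm _ _ (by omega) (by omega) hi hi'.le)
  · exact (H a b d hab hbd).lt_of_ne
      (hc.ne a b d hab hbd l l' hl _ _ (by omega) (by omega) hj hj'.le)

/-- Each of the four ways in which the non-overlapping intervals can be placed yields a cyclic chain
of inequalities among the crossings of five paths. -/
lemma overlap_xz_zero_three (hc : RegularFamily m c) {v₀ v₁ v₂ v₃ v₄ : V} (h₀ : v₀ < v₁)
    (h₁ : v₁ < v₂) (h₂ : v₂ < v₃) (h₃ : v₃ < v₄) (hm : 3 ≤ m)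
    (h₂₃ : Overlap c Letter.x 2 Letter.z 3) (h₀₁ : Overlap c Letter.x 0 Letter.z 1)
    (hB : ¬ Overlap c Letter.y 2 Letter.z 2) (hA : ¬ Overlap c Letter.x 1 Letter.y 1) :
    Overlap c Letter.x 0 Letter.z 3 := by
  by_contra H
  have k₀₂ := h₀.trans h₁
  have k₁₃ := h₁.trans h₂
  have k₂₄ := h₂.trans h₃
  have H' : ∀ a b d, a < b → b < d → c a b 1 < c b d 3 := by
    rcases hc.disjoint_of_not_overlap H with H | H
    · have := H _ _ _ h₀ h₁
      have := hc.letterSeq_pos h₀ h₁ Letter.z hm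
      have := hc.letterSeq_zero h₀ h₁ Letter.x
      linarith
    · exact fun a b d hab hbd => (H a b d hab hbd).lt_of_ne
        (hc.ne a b d hab hbd Letter.x Letter.z (by simp) 1 3 (by simp) (by omega) (by simp) hm)
  rcases hc.disjoint_of_not_overlap_of_lt (by simp) (by simp) (by omega) (by simp) (by omega) hB
    with B | B <;>
  rcases hc.disjoint_of_not_overlap_of_lt (by simp) (by simp) (by omega) (by simp) (by omega) hA
    with A | A
  · have e₁ := H' _ _ _ h₀ h₁
    have e₂ := B _ _ _ h₀ h₁
    have e₃ := A _ _ _ h₀ h₁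
    simp only [letterSeq] at e₁ e₂ e₃
    linarith
  · have e₁ := A _ _ _ k₀₂ h₂
    have e₂ := H' _ _ _ (k₀₂.trans h₂) h₃
    have e₃ := (h₂₃ _ _ _ h₂ h₃).2
    have e₄ := (h₂₃ _ _ _ h₁ h₂).2
    have e₅ := B _ _ _ h₀ h₁
    simp only [letterSeq] at e₁ e₂ e₃ e₄ e₅
    linarith
  · have e₁ := H' _ _ _ h₀ (h₁.trans k₂₄)
    have e₂ := B _ _ _ h₁ k₂₄
    have e₃ := A _ _ _ h₂ h₃
    have e₄ := (h₀₁ _ _ _ h₁ h₂).2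
    have e₅ := (h₀₁ _ _ _ h₀ h₁).2
    simp only [letterSeq] at e₁ e₂ e₃ e₄ e₅
    linarith
  · have e₁ := H' _ _ _ h₀ k₁₃
    have e₂ := B _ _ _ h₁ h₂
    have e₃ := A _ _ _ h₂ h₃
    have e₄ := (h₀₁ _ _ _ h₁ k₂₄).2
    have e₅ := (h₀₁ _ _ _ h₀ h₁).2
    simp only [letterSeq] at e₁ e₂ e₃ e₄ e₅
    linarith

/-- The mirror image of `overlap_xz_zero_three` under reversal of the time axis, for `m = 4`. -/
lemma overlap_xz_four_one (hc : RegularFamily 4 c) {v₀ v₁ v₂ v₃ v₄ : V} (h₀ : v₀ < v₁)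
    (h₁ : v₁ < v₂) (h₂ : v₂ < v₃) (h₃ : v₃ < v₄)
    (h₂₁ : Overlap c Letter.x 2 Letter.z 1) (h₄₃ : Overlap c Letter.x 4 Letter.z 3)
    (hB : ¬ Overlap c Letter.y 2 Letter.z 2) (hA : ¬ Overlap c Letter.x 3 Letter.y 3) :
    Overlap c Letter.x 4 Letter.z 1 := by
  by_contra H
  have k₀₂ := h₀.trans h₁
  have k₁₃ := h₁.trans h₂
  have k₂₄ := h₂.trans h₃
  have H' : ∀ a b d, a < b → b < d → c b d 2 < c a b 4 := by
    rcases hc.disjoint_of_not_overlap H with H | H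
    · exact fun a b d hab hbd => (H a b d hab hbd).lt_of_ne
        (hc.ne a b d hab hbd Letter.z Letter.x (by simp) 2 4 (by simp) (by simp) (by simp) le_rfl)
    · have := H _ _ _ h₀ h₁
      have := hc.letterSeq_lt_one h₀ h₁ Letter.z (i := 1) (by simp)
      have := hc.letterSeq_last h₀ h₁ Letter.x
      linarith
  rcases hc.disjoint_of_not_overlap_of_lt (by simp) (by simp) (by simp) (by simp) (by simp) hB
    with B | B <;>
  rcases hc.disjoint_of_not_overlap_of_lt (by simp) (by simp) (by simp) (by simp) (by simp) hA
    with A | A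
  · have e₁ := (h₄₃ _ _ _ h₀ h₁).1
    have e₂ := (h₄₃ _ _ _ h₁ k₂₄).1
    have e₃ := A _ _ _ h₂ h₃
    have e₄ := B _ _ _ h₁ h₂
    have e₅ := H' _ _ _ h₀ k₁₃
    simp only [letterSeq] at e₁ e₂ e₃ e₄ e₅
    linarith
  · have e₁ := (h₄₃ _ _ _ h₀ h₁).1
    have e₂ := (h₄₃ _ _ _ h₁ h₂).1
    have e₃ := A _ _ _ h₂ h₃
    have e₄ := B _ _ _ h₁ k₂₄
    have e₅ := H' _ _ _ h₀ (h₁.trans k₂₄)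
    simp only [letterSeq] at e₁ e₂ e₃ e₄ e₅
    linarith
  · have e₁ := B _ _ _ h₀ h₁
    have e₂ := (h₂₁ _ _ _ h₁ h₂).1
    have e₃ := (h₂₁ _ _ _ h₂ h₃).1
    have e₄ := H' _ _ _ (k₀₂.trans h₂) h₃
    have e₅ := A _ _ _ k₀₂ h₂
    simp only [letterSeq] at e₁ e₂ e₃ e₄ e₅
    linarith
  · have e₁ := A _ _ _ h₀ h₁
    have e₂ := B _ _ _ h₀ h₁
    have e₃ := H' _ _ _ h₀ h₁
    simp only [letterSeq] at e₁ e₂ e₃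
    linarith

/-- If every path lies, somewhere, above any two others and each pair crosses at most twice, then
suitable intervals overlap for all triples. -/
lemma exists_overlap_of_two (hc : RegularFamily m c) {v₀ v₁ v₂ : V} (h₀ : v₀ < v₁) (h₁ : v₁ < v₂)
    (hm : m ≤ 2)
    (hab : ∀ p, ∀ Q : Finset V, Q.card ≤ 2 → p ∉ Q → ∃ t, ∀ q ∈ Q, AboveAt m c p q t) :
    ∃ i l, Odd i ∧ i ≤ m ∧ Even l ∧ l ≤ m ∧ Overlap c Letter.x i Letter.y i ∧
      Overlap c Letter.y l Letter.z l ∧ Overlap c Letter.x l Letter.z i := by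
  have k := h₀.trans h₁
  have one : ∀ {i}, i ≤ m → Odd i → i = 1 := fun {i} hi ho => by
    obtain ⟨r, rfl⟩ := ho
    omega
  obtain ⟨t, ht⟩ := hab v₀ {v₁, v₂} Finset.card_le_two (by simp [h₀.ne, k.ne])
  obtain ⟨i, him, hi, -, i₁, i₂⟩ := ht v₁ (by simp)
  obtain ⟨j, hjm, hj, -, j₁, j₂⟩ := ht v₂ (by simp)
  obtain rfl := one him (hi h₀)
  obtain rfl := one hjm (hj k)
  have hA := hc.overlap_of_mem h₀ h₁ (l := Letter.x) (l' := Letter.y) i₁ i₂ j₁ j₂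
  obtain ⟨s, hs⟩ := hab v₁ {v₀, v₂} Finset.card_le_two (by simp [h₀.ne', h₁.ne])
  obtain ⟨l, hlm, -, hl, l₁, l₂⟩ := hs v₀ (by simp)
  obtain ⟨j, hjm', hj', -, j₁', j₂'⟩ := hs v₂ (by simp)
  obtain rfl := one hjm' (hj' h₁)
  rw [hc.symm] at l₁ l₂
  refine ⟨1, l, by simp, him, hl h₀, hlm, hA, ?_,
    hc.overlap_of_mem h₀ h₁ (l := Letter.x) (l' := Letter.z) l₁ l₂ j₁' j₂'⟩
  obtain ⟨r, rfl⟩ := hl h₀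
  rcases Nat.eq_zero_or_pos r with rfl | hr
  · exact hc.overlap_zero _ _
  · obtain rfl : m = r + r := by omega
    exact hc.overlap_last _ _

/-- If every path lies, somewhere, above any three others and each pair crosses at most four times,
then suitable intervals overlap for all triples. The path `v₁` provides intervals for the pairs
`x`, `y` and for the pairs `x`, `z`; the path `v₂` for the pairs `y`, `z` and for the pairs
`x`, `z`. In the few cases where these do not fit together, `overlap_xz_zero_three` or
`overlap_xz_four_one` applies. -/
lemma exists_overlap_of_three (hc : RegularFamily m c) {v₀ v₁ v₂ v₃ v₄ : V} (h₀ : v₀ < v₁)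
    (h₁ : v₁ < v₂) (h₂ : v₂ < v₃) (h₃ : v₃ < v₄) (hm : m ≤ 4)
    (hab : ∀ p, ∀ Q : Finset V, Q.card ≤ 3 → p ∉ Q → ∃ t, ∀ q ∈ Q, AboveAt m c p q t) :
    ∃ i l, Odd i ∧ i ≤ m ∧ Even l ∧ l ≤ m ∧ Overlap c Letter.x i Letter.y i ∧
      Overlap c Letter.y l Letter.z l ∧ Overlap c Letter.x l Letter.z i := by
  have k₀₂ := h₀.trans h₁
  have k₁₃ := h₁.trans h₂
  have first : ∃ i l, Odd i ∧ i ≤ m ∧ Even l ∧ l ≤ m ∧ Overlap c Letter.x i Letter.y i ∧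
      Overlap c Letter.x l Letter.z i := by
    obtain ⟨t, ht⟩ := hab v₁ {v₀, v₂, v₃} Finset.card_le_three (by simp [h₀.ne', h₁.ne, k₁₃.ne])
    obtain ⟨l, hlm, -, hl, l₁, l₂⟩ := ht v₀ (by simp)
    obtain ⟨i, him, hi, -, i₁, i₂⟩ := ht v₂ (by simp)
    obtain ⟨j, hjm, hj, -, j₁, j₂⟩ := ht v₃ (by simp)
    rw [hc.symm] at l₁ l₂
    rcases hc.overlap_xy h₀ h₁ h₂ h₃ him hjm
      (hc.overlap_of_mem h₁ h₂ (l := Letter.x) (l' := Letter.y) i₁ i₂ j₁ j₂) with h | h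
    · exact ⟨i, l, hi h₁, him, hl h₀, hlm, h,
        hc.overlap_of_mem h₀ h₁ (l := Letter.x) (l' := Letter.z) l₁ l₂ i₁ i₂⟩
    · exact ⟨j, l, hj k₁₃, hjm, hl h₀, hlm, h,
        hc.overlap_of_mem h₀ k₁₃ (l := Letter.x) (l' := Letter.z) l₁ l₂ j₁ j₂⟩
  have second : ∃ i l, Odd i ∧ i ≤ m ∧ Even l ∧ l ≤ m ∧ Overlap c Letter.y l Letter.z l ∧
      Overlap c Letter.x l Letter.z i := by
    obtain ⟨t, ht⟩ := hab v₂ {v₀, v₁, v₃} Finset.card_le_three (by simp [k₀₂.ne', h₁.ne', h₂.ne])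
    obtain ⟨l, hlm, -, hl, l₁, l₂⟩ := ht v₀ (by simp)
    obtain ⟨j, hjm, -, hj, j₁, j₂⟩ := ht v₁ (by simp)
    obtain ⟨i, him, hi, -, i₁, i₂⟩ := ht v₃ (by simp)
    rw [hc.symm] at l₁ l₂ j₁ j₂
    rcases hc.overlap_yz h₀ h₁ h₂ h₃ hlm hjm
      (hc.overlap_of_mem h₀ h₁ (l := Letter.y) (l' := Letter.z) l₁ l₂ j₁ j₂) with h | h
    · exact ⟨i, l, hi h₂, him, hl k₀₂, hlm, h,
        hc.overlap_of_mem k₀₂ h₂ (l := Letter.x) (l' := Letter.z) l₁ l₂ i₁ i₂⟩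
    · exact ⟨i, j, hi h₂, him, hj h₁, hjm, h,
        hc.overlap_of_mem h₁ h₂ (l := Letter.x) (l' := Letter.z) j₁ j₂ i₁ i₂⟩
  obtain ⟨i, l, hi, him, hl, hlm, hA, hX⟩ := first
  obtain ⟨i', l', hi', him', hl', hlm', hB, hX'⟩ := second
  by_cases b₁ : Overlap c Letter.y l Letter.z l
  · exact ⟨i, l, hi, him, hl, hlm, hA, b₁, hX⟩
  by_cases b₂ : Overlap c Letter.x i' Letter.y i'
  · exact ⟨i', l', hi', him', hl', hlm', b₂, hB, hX'⟩
  refine ⟨i, l', hi, him, hl', hlm', hA, hB, ?_⟩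
  have n₁ : l ≠ 0 := by rintro rfl; exact b₁ (hc.overlap_zero _ _)
  have n₂ : l ≠ m := by rintro rfl; exact b₁ (hc.overlap_last _ _)
  have n₃ : i' ≠ m := by rintro rfl; exact b₂ (hc.overlap_last _ _)
  have n₄ : l ≠ l' := by rintro rfl; exact b₁ hB
  have n₅ : i ≠ i' := by rintro rfl; exact b₂ hA
  obtain ⟨r, rfl⟩ := hi
  obtain ⟨r', rfl⟩ := hi'
  obtain ⟨s, rfl⟩ := hl
  obtain ⟨s', rfl⟩ := hl'
  obtain rfl : s = 1 := by omega
  have hs' : s' = 0 ∨ s' = 2 ∧ m = 4 := by omega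
  have hr : (r = 0 ∧ r' = 1) ∨ (r = 1 ∧ r' = 0) := by omega
  rcases hs' with rfl | ⟨rfl, rfl⟩ <;> rcases hr with ⟨rfl, rfl⟩ | ⟨rfl, rfl⟩
  · intro a b d hab hbd
    refine ⟨?_, (hc.lt_of_lt hbd.ne (by norm_num) (by omega)).trans (hX' a b d hab hbd).2⟩
    have e₁ := hc.letterSeq_zero hab hbd Letter.x
    have e₂ := hc.letterSeq_pos hab hbd Letter.z (i := 1) (by omega)
    change c a b 0 < c b d 2
    change c a b 0 = -1 at e₁
    change 0 < c b d 2 at e₂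
    linarith
  · exact hc.overlap_xz_zero_three h₀ h₁ h₂ h₃ (by omega) hX hX' b₁ b₂
  · exact hc.overlap_xz_four_one h₀ h₁ h₂ h₃ hX hX' b₁ b₂
  · intro a b d hab hbd
    refine ⟨((hX' a b d hab hbd).1).trans (hc.lt_of_lt hbd.ne (by norm_num) (by omega)), ?_⟩
    have e₁ := hc.letterSeq_last hab hbd Letter.x
    have e₂ := hc.letterSeq_lt_one hab hbd Letter.z (i := 3) (by omega)
    change c b d 3 < c a b 5
    change c a b 5 = 2 at e₁
    change c b d 3 < 1 at e₂
    linarith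

/-- If every path lies, somewhere, above any four others, then suitable intervals overlap for all
triples: the path `v₂`, compared with two paths on either side, provides all of them at once. -/
lemma exists_overlap_of_four (hc : RegularFamily m c) {v₀ v₁ v₂ v₃ v₄ : V} (h₀ : v₀ < v₁)
    (h₁ : v₁ < v₂) (h₂ : v₂ < v₃) (h₃ : v₃ < v₄)
    (hab : ∀ p, ∀ Q : Finset V, Q.card ≤ 4 → p ∉ Q → ∃ t, ∀ q ∈ Q, AboveAt m c p q t) :
    ∃ i l, Odd i ∧ i ≤ m ∧ Even l ∧ l ≤ m ∧ Overlap c Letter.x i Letter.y i ∧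
      Overlap c Letter.y l Letter.z l ∧ Overlap c Letter.x l Letter.z i := by
  have k₀₂ := h₀.trans h₁
  have k₂₄ := h₂.trans h₃
  obtain ⟨t, ht⟩ := hab v₂ {v₀, v₁, v₃, v₄} Finset.card_le_four
    (by simp [k₀₂.ne', h₁.ne', h₂.ne, k₂₄.ne])
  obtain ⟨l, hlm, -, hl, l₁, l₂⟩ := ht v₀ (by simp)
  obtain ⟨l', hlm', -, hl', l₁', l₂'⟩ := ht v₁ (by simp)
  obtain ⟨i, him, hi, -, i₁, i₂⟩ := ht v₃ (by simp)
  obtain ⟨i', him', hi', -, i₁', i₂'⟩ := ht v₄ (by simp)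
  rw [hc.symm] at l₁ l₂ l₁' l₂'
  have hX : ∀ j ∈ ({i, i'} : Set ℕ), ∀ r ∈ ({l, l'} : Set ℕ), Overlap c Letter.x r Letter.z j := by
    rintro j (rfl | rfl) r (rfl | rfl)
    exacts [hc.overlap_of_mem k₀₂ h₂ (l := Letter.x) (l' := Letter.z) l₁ l₂ i₁ i₂,
      hc.overlap_of_mem h₁ h₂ (l := Letter.x) (l' := Letter.z) l₁' l₂' i₁ i₂,
      hc.overlap_of_mem k₀₂ k₂₄ (l := Letter.x) (l' := Letter.z) l₁ l₂ i₁' i₂',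
      hc.overlap_of_mem h₁ k₂₄ (l := Letter.x) (l' := Letter.z) l₁' l₂' i₁' i₂']
  obtain ⟨j, hj, hjo, hjm, hA⟩ : ∃ j ∈ ({i, i'} : Set ℕ), Odd j ∧ j ≤ m ∧
      Overlap c Letter.x j Letter.y j := by
    rcases hc.overlap_xy h₀ h₁ h₂ h₃ him him'
      (hc.overlap_of_mem h₂ h₃ (l := Letter.x) (l' := Letter.y) i₁ i₂ i₁' i₂') with h | h
    exacts [⟨i, by simp, hi h₂, him, h⟩, ⟨i', by simp, hi' k₂₄, him', h⟩]
  obtain ⟨r, hr, hre, hrm, hB⟩ : ∃ r ∈ ({l, l'} : Set ℕ), Even r ∧ r ≤ m ∧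
      Overlap c Letter.y r Letter.z r := by
    rcases hc.overlap_yz h₀ h₁ h₂ h₃ hlm hlm'
      (hc.overlap_of_mem h₀ h₁ (l := Letter.y) (l' := Letter.z) l₁ l₂ l₁' l₂') with h | h
    exacts [⟨l, by simp, hl k₀₂, hlm, h⟩, ⟨l', by simp, hl' h₁, hlm', h⟩]
  exact ⟨j, r, hjo, hjm, hre, hrm, hA, hB, hX j hj r hr⟩

end RegularFamily

/-! ### The crossings of two paths in increasing order -/

/-- The elements of a finite set `F` of abscissae in increasing order, numbered from `1`, preceded
by `-1` as number `0` and followed by `2`. -/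
noncomputable def nthPoint (F : Finset unitInterval) (i : ℕ) : ℝ :=
  if i = 0 then -1 else if h : i - 1 < F.card then F.orderEmbOfFin rfl ⟨i - 1, h⟩ else 2

lemma nthPoint_zero (F : Finset unitInterval) : nthPoint F 0 = -1 := if_pos rfl

lemma nthPoint_succ (F : Finset unitInterval) {i : ℕ} (hi : i < F.card) :
    nthPoint F (i + 1) = F.orderEmbOfFin rfl ⟨i, hi⟩ := by
  simp [nthPoint, hi]

lemma nthPoint_last (F : Finset unitInterval) : nthPoint F (F.card + 1) = 2 := by
  simp [nthPoint]

lemma exists_nthPoint_eq {F : Finset unitInterval} {u : unitInterval} (hu : u ∈ F) :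
    ∃ i, 1 ≤ i ∧ i ≤ F.card ∧ nthPoint F i = u := by
  have : u ∈ Set.range (F.orderEmbOfFin rfl) := by rw [Finset.range_orderEmbOfFin]; exact hu
  obtain ⟨⟨j, hj⟩, rfl⟩ := this
  exact ⟨j + 1, by simp, hj, nthPoint_succ F hj⟩

lemma exists_mem_eq_nthPoint {F : Finset unitInterval} {i : ℕ} (h₁ : 1 ≤ i) (h₂ : i ≤ F.card) :
    ∃ u ∈ F, nthPoint F i = u := by
  obtain ⟨j, rfl⟩ := Nat.exists_eq_add_of_le' h₁
  exact ⟨_, Finset.orderEmbOfFin_mem F rfl ⟨j, h₂⟩, nthPoint_succ F h₂⟩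

lemma nthPoint_lt_succ (F : Finset unitInterval) {i : ℕ} (hi : i ≤ F.card) :
    nthPoint F i < nthPoint F (i + 1) := by
  rcases Nat.eq_zero_or_pos i with rfl | h₀ <;> rcases hi.eq_or_lt with h | h
  · rw [h, nthPoint_last, ← h, nthPoint_zero]; norm_num
  · obtain ⟨u, -, hu⟩ := exists_mem_eq_nthPoint (F := F) (i := 0 + 1) le_rfl h
    rw [nthPoint_zero, hu]
    linarith [u.2.1]
  · obtain ⟨u, -, hu⟩ := exists_mem_eq_nthPoint h₀ hi
    rw [hu, h, nthPoint_last]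
    linarith [u.2.2]
  · obtain ⟨j, rfl⟩ := Nat.exists_eq_add_of_le' h₀
    rw [nthPoint_succ F hi, nthPoint_succ F h]
    exact_mod_cast (F.orderEmbOfFin rfl).strictMono (by simp)

lemma nthPoint_lt {F : Finset unitInterval} {i j : ℕ} (hij : i < j) (hj : j ≤ F.card + 1) :
    nthPoint F i < nthPoint F j := by
  induction j, hij using Nat.le_induction with
  | base => exact nthPoint_lt_succ F (by omega)
  | succ j hij ih => exact (ih (by omega)).trans (nthPoint_lt_succ F (by omega))

lemma notMem_of_nthPoint_lt {F : Finset unitInterval} {u : unitInterval} {i : ℕ}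
    (hi : i ≤ F.card) (h₁ : nthPoint F i < u) (h₂ : u < nthPoint F (i + 1)) : u ∉ F := by
  intro hu
  obtain ⟨j, -, hj, hju⟩ := exists_nthPoint_eq hu
  rw [← hju] at h₁ h₂
  rcases lt_or_ge i j with h | h
  · rcases (Nat.succ_le_of_lt h).eq_or_lt with rfl | h'
    · exact h₂.false
    · exact (nthPoint_lt h' (by omega)).not_gt h₂
  · rcases h.eq_or_lt with rfl | h'
    · exact h₁.false
    · exact (nthPoint_lt h' (by omega)).not_gt h₁

lemma exists_nthPoint_lt_lt {F : Finset unitInterval} {u : unitInterval} (hu : u ∉ F) :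
    ∃ i ≤ F.card, nthPoint F i < u ∧ u < nthPoint F (i + 1) := by
  classical
  have h₀ : nthPoint F 0 < u := by rw [nthPoint_zero]; linarith [u.2.1]
  have hP := Nat.findGreatest_spec (P := fun i => nthPoint F i < u) (Nat.zero_le F.card) h₀
  have hle := Nat.findGreatest_le (P := fun i => nthPoint F i < u) F.card
  have hgr := Nat.findGreatest_is_greatest (P := fun i => nthPoint F i < u) (n := F.card)
    (k := Nat.findGreatest (fun i => nthPoint F i < u) F.card + 1) (Nat.lt_succ_self _)
  generalize Nat.findGreatest (fun i => nthPoint F i < u) F.card = i at *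
  refine ⟨i, hle, hP, ?_⟩
  rcases hle.eq_or_lt with rfl | h
  · rw [nthPoint_last]; linarith [u.2.2]
  · obtain ⟨v, hv, hv'⟩ := exists_mem_eq_nthPoint (F := F) (i := i + 1) (by simp) h
    refine (not_lt.1 (hgr h)).lt_of_ne fun h => hu ?_
    rw [hv'] at h
    rwa [Subtype.ext h]

/-- The vertical order of two paths does not change on an interval without intersections. -/
lemma lt_of_forall_ne {f g : Path01} {u v : unitInterval} (huv : u ≤ v)
    (h : ∀ s ∈ Set.Icc u v, f s ≠ g s) (hu : f u < g u) : f v < g v := by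
  by_contra hv
  obtain ⟨s, hs, hs'⟩ := isPreconnected_Icc.intermediate_value₂ (Set.left_mem_Icc.2 huv)
    (Set.right_mem_Icc.2 huv) f.continuous.continuousOn g.continuous.continuousOn hu.le
    (not_lt.1 hv)
  exact h s hs hs'

/-- Between two consecutive crossings, `f` is below `g` or above it according to the parity of the
number of preceding crossings. -/
lemma lt_of_nthPoint {f g : Path01} (h₀ : f 0 < g 0) {F : Finset unitInterval}
    (hF : (F : Set unitInterval) = meet f g) (hcr : ∀ t ∈ meet f g, CrossAt f g t) (i : ℕ)
    (hi : i ≤ F.card) (t : unitInterval) (h₁ : nthPoint F i < t) (h₂ : t < nthPoint F (i + 1)) :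
    (Even i → f t < g t) ∧ (Odd i → g t < f t) := by
  have hmem : ∀ s, s ∉ F → f s ≠ g s := fun s hs h =>
    hs (Finset.mem_coe.1 (hF ▸ h : s ∈ (F : Set unitInterval)))
  induction i generalizing t with
  | zero =>
    refine ⟨fun _ => lt_of_forall_ne (u := 0) t.2.1 (fun s hs => hmem s ?_) h₀, by simp⟩
    refine notMem_of_nthPoint_lt hi ?_ ((Subtype.coe_le_coe.2 hs.2).trans_lt h₂)
    rw [nthPoint_zero]
    linarith [s.2.1]
  | succ i ih =>
    obtain ⟨s, hsF, hs⟩ := exists_mem_eq_nthPoint (F := F) (i := i + 1) (by simp) hi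
    have hst : s < t := by rw [hs] at h₁; exact h₁
    have hs₀ : 0 < s := by
      refine lt_of_le_of_ne s.2.1 fun h => h₀.ne ?_
      have hm : s ∈ meet f g := hF ▸ Finset.mem_coe.2 hsF
      rw [h]
      exact hm
    have hleft : ∃ᶠ u : unitInterval in 𝓝[<] s, nthPoint F i < u ∧ u < s := by
      have : (𝓝[<] s).NeBot := nhdsLT_neBot_of_exists_lt ⟨0, hs₀⟩
      refine Filter.Eventually.frequently ?_
      have hlt : nthPoint F i < s := by rw [← hs]; exact nthPoint_lt_succ F (by omega)
      have hev : ∀ᶠ u : unitInterval in 𝓝[<] s, nthPoint F i < u :=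
        (continuous_subtype_val.continuousAt.eventually_const_lt hlt).filter_mono
          nhdsWithin_le_nhds
      filter_upwards [hev, self_mem_nhdsWithin] with u hu hu' using ⟨hu, hu'⟩
    have hright : ∃ᶠ u : unitInterval in 𝓝[>] s, s < u ∧ u < t := by
      have : (𝓝[>] s).NeBot := nhdsGT_neBot_of_exists_gt ⟨t, hst⟩
      refine Filter.Eventually.frequently ?_
      filter_upwards [Ioo_mem_nhdsGT hst] with u hu using hu
    have hbefore : ∀ u : unitInterval, nthPoint F i < u ∧ u < s →
        (Even i → f u < g u) ∧ (Odd i → g u < f u) := fun u hu =>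
      ih (by omega) u hu.1 (by rw [hs]; exact hu.2)
    have hafter : ∀ u : unitInterval, s < u ∧ u < t → ∀ v ∈ Set.Icc u t, f v ≠ g v :=
      fun u hu v hv => hmem v (notMem_of_nthPoint_lt hi
        (by rw [hs]; exact hu.1.trans_le hv.1) ((Subtype.coe_le_coe.2 hv.2).trans_lt h₂))
    rw [Nat.even_add_one, Nat.odd_add_one, Nat.not_even_iff_odd, Nat.not_odd_iff_even]
    rcases hcr s (hF ▸ Finset.mem_coe.2 hsF) with ⟨hl, hr⟩ | ⟨hl, hr⟩
    · obtain ⟨u, hu, hu'⟩ := (hleft.and_eventually hl).exists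
      obtain ⟨v, hv, hv'⟩ := (hright.and_eventually hr).exists
      exact ⟨fun hodd => absurd ((hbefore u hu).2 hodd) hu'.not_gt, fun _ =>
        lt_of_forall_ne hv.2.le (fun w hw => (hafter v hv w hw).symm) hv'⟩
    · obtain ⟨u, hu, hu'⟩ := (hleft.and_eventually hl).exists
      obtain ⟨v, hv, hv'⟩ := (hright.and_eventually hr).exists
      exact ⟨fun _ => lt_of_forall_ne hv.2.le (hafter v hv) hv',
        fun heven => absurd ((hbefore u hu).1 heven) hu'.not_gt⟩

/-- For finite sets of positions `W`, `W'`, the order of the points at these positions in an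
increasing sequence does not depend on the sequence. -/
lemma nthPoint_map_lt {L : ℕ} {τ τ' : Fin L ↪o unitInterval} {W W' : Finset (Fin L)} {i j : ℕ}
    (h : nthPoint (W.map τ.toEmbedding) i < nthPoint (W'.map τ.toEmbedding) j) :
    nthPoint (W.map τ'.toEmbedding) i < nthPoint (W'.map τ'.toEmbedding) j := by
  have key : ∀ (σ : Fin L ↪o unitInterval) (W : Finset (Fin L)) (k : ℕ) (hk : k < W.card),
      nthPoint (W.map σ.toEmbedding) (k + 1) = σ (W.orderEmbOfFin rfl ⟨k, hk⟩) := by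
    intro σ W k hk
    have hc : (W.map σ.toEmbedding).card = W.card := Finset.card_map _
    rw [nthPoint_succ _ (hk.trans_eq hc.symm)]
    have h₁ := Finset.orderEmbOfFin_unique (s := W.map σ.toEmbedding) hc
      (f := fun x => σ (W.orderEmbOfFin rfl x))
      (fun x => Finset.mem_map_of_mem _ (Finset.orderEmbOfFin_mem W rfl x))
      (σ.strictMono.comp (W.orderEmbOfFin rfl).strictMono)
    have h₂ := congrFun h₁ ⟨k, hk⟩
    rw [show σ (W.orderEmbOfFin rfl ⟨k, hk⟩) = _ from h₂]
    congr 1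
  have big : ∀ (σ : Fin L ↪o unitInterval) (W : Finset (Fin L)) (k : ℕ), W.card ≤ k →
      nthPoint (W.map σ.toEmbedding) (k + 1) = 2 := fun σ W k hk => by
    simp [nthPoint, hk.not_gt]
  rcases i with _ | i
  · rcases j with _ | j
    · simp [nthPoint_zero] at h
    · rw [nthPoint_zero]
      rcases lt_or_ge j W'.card with hj | hj
      · rw [key _ _ _ hj]
        linarith [(τ' (W'.orderEmbOfFin rfl ⟨j, hj⟩)).2.1]
      · rw [big _ _ _ hj]; norm_num
  · rcases j with _ | j
    · rw [nthPoint_zero] at h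
      rcases lt_or_ge i W.card with hi | hi
      · rw [key _ _ _ hi] at h
        linarith [(τ (W.orderEmbOfFin rfl ⟨i, hi⟩)).2.1]
      · rw [big _ _ _ hi] at h; norm_num at h
    · rcases lt_or_ge i W.card with hi | hi <;> rcases lt_or_ge j W'.card with hj | hj
      · rw [key _ _ _ hi, key _ _ _ hj] at *
        have h' : τ (W.orderEmbOfFin rfl ⟨i, hi⟩) < τ (W'.orderEmbOfFin rfl ⟨j, hj⟩) := h
        exact τ'.strictMono (τ.lt_iff_lt.1 h')
      · rw [key _ _ _ hi, big _ _ _ hj]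
        linarith [(τ' (W.orderEmbOfFin rfl ⟨i, hi⟩)).2.2]
      · rw [big _ _ _ hi, key _ _ _ hj] at h
        linarith [(τ (W'.orderEmbOfFin rfl ⟨j, hj⟩)).2.2]
      · rw [big _ _ _ hi, big _ _ _ hj] at h
        exact absurd h (lt_irrefl _)

/-! ### Signatures -/

lemma meet_comm (f g : Path01) : meet f g = meet g f := by
  ext t; exact eq_comm

lemma IsSystem.mono {S T : Finset Path01} (hS : IsSystem S) (hT : T ⊆ S) (h : 3 ≤ T.card) :
    IsSystem T where
  three_le_card := h
  left_ne f hf g hg := hS.left_ne f (hT hf) g (hT hg)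
  right_ne f hf g hg := hS.right_ne f (hT hf) g (hT hg)
  finite_meet f hf g hg := hS.finite_meet f (hT hf) g (hT hg)
  crossAt f hf g hg := hS.crossAt f (hT hf) g (hT hg)
  no_triple f hf g hg h hh := hS.no_triple f (hT hf) g (hT hg) h (hT hh)

/-- The paths of a system can be listed from bottom to top by their left endpoints. -/
lemma IsSystem.exists_listing {S : Finset Path01} (hS : IsSystem S) :
    ∃ P : Fin S.card → Path01, StrictMono (fun i => P i 0) ∧ Set.range P = S := by
  classical
  have hinj : Set.InjOn (fun f : Path01 => f 0) S := fun f hf g hg h => by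
    by_contra hne
    exact hS.left_ne f hf g hg hne h
  have hcard : (S.image fun f : Path01 => f 0).card = S.card := Finset.card_image_of_injOn hinj
  choose P hP hP' using fun i =>
    Finset.mem_image.1 (Finset.orderEmbOfFin_mem (S.image fun f : Path01 => f 0) hcard i)
  refine ⟨P, fun i j hij => ?_, ?_⟩
  · simp only [hP']
    exact ((S.image fun f : Path01 => f 0).orderEmbOfFin hcard).strictMono hij
  · ext f
    refine ⟨fun ⟨i, hi⟩ => hi ▸ hP i, fun hf => ?_⟩
    have hr : f 0 ∈ Set.range ((S.image fun f : Path01 => f 0).orderEmbOfFin hcard) := by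
      rw [Finset.range_orderEmbOfFin]
      exact Finset.mem_coe.2 (Finset.mem_image_of_mem _ hf)
    obtain ⟨i, hi⟩ := hr
    exact ⟨i, hinj (hP i) hf ((hP' i).trans hi)⟩

/-- The word `w` records the crossings of three paths listed in the order of their left
endpoints. -/
def Records (f₁ f₂ f₃ : Path01) (w : List Letter) : Prop :=
  ∃ τ : Fin w.length → unitInterval, StrictMono τ ∧
    ∀ (l : Letter) (t : unitInterval), t ∈ letterMeet f₁ f₂ f₃ l ↔ ∃ i, τ i = t ∧ w.get i = l

lemma exists_records {f₁ f₂ f₃ : Path01} (h₁ : (meet f₁ f₂).Finite) (h₂ : (meet f₁ f₃).Finite)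
    (h₃ : (meet f₂ f₃).Finite) (h : ∀ t, ¬ (f₁ t = f₂ t ∧ f₂ t = f₃ t)) :
    ∃ w, Records f₁ f₂ f₃ w := by
  classical
  let F : Finset unitInterval := ((h₁.union h₂).union h₃).toFinset
  have hF : ∀ t, t ∈ F ↔ (f₁ t = f₂ t ∨ f₁ t = f₃ t) ∨ f₂ t = f₃ t := fun t => by
    simp [F, meet]
  let σ := F.orderEmbOfFin rfl
  let letter : unitInterval → Letter := fun t =>
    if f₁ t = f₂ t then Letter.x else if f₁ t = f₃ t then Letter.y else Letter.z
  have hletter : ∀ t ∈ F, ∀ l, t ∈ letterMeet f₁ f₂ f₃ l ↔ letter t = l := by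
    intro t ht l
    have h₁ := (hF t).1 ht
    have h₂ := h t
    clear hF h
    cases l <;> simp only [letterMeet, meet, Set.mem_ofPred_eq, letter] <;> split_ifs <;> grind
  refine ⟨List.ofFn fun i => letter (σ i), fun i => σ (i.cast (by simp)), ?_, ?_⟩
  · exact fun i j hij => σ.strictMono (by simpa using hij)
  · intro l t
    constructor
    · intro ht
      have htF : t ∈ F := by
        rw [hF]
        cases l
        exacts [Or.inl (Or.inl ht), Or.inl (Or.inr ht), Or.inr ht]
      have : t ∈ Set.range σ := by rw [Finset.range_orderEmbOfFin]; exact htF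
      obtain ⟨i, rfl⟩ := this
      exact ⟨i.cast (by simp), by simp, by simpa using (hletter _ htF l).1 ht⟩
    · rintro ⟨i, rfl, hi⟩
      rw [hletter _ (Finset.orderEmbOfFin_mem F rfl _) l]
      rw [List.get_ofFn] at hi
      exact hi

lemma IsSystem.exists_records {S : Finset Path01} (hS : IsSystem S) {f₁ f₂ f₃ : Path01}
    (h₁ : f₁ ∈ S) (h₂ : f₂ ∈ S) (h₃ : f₃ ∈ S) (h₁₂ : f₁ 0 < f₂ 0) (h₂₃ : f₂ 0 < f₃ 0) :
    ∃ w, Records f₁ f₂ f₃ w := by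
  have ne : ∀ {f g : Path01}, f 0 < g 0 → f ≠ g := fun h e => by simp [e] at h
  exact PathSystem.exists_records (hS.finite_meet _ h₁ _ h₂ (ne h₁₂))
    (hS.finite_meet _ h₁ _ h₃ (ne (h₁₂.trans h₂₃))) (hS.finite_meet _ h₂ _ h₃ (ne h₂₃))
    (hS.no_triple _ h₁ _ h₂ _ h₃ (ne h₁₂) (ne (h₁₂.trans h₂₃)) (ne h₂₃))

lemma mem_signatures {k : ℕ} {S : Finset Path01} (hS : IsSystem S) (hk : IsCrossing k S)
    {f₁ f₂ f₃ : Path01} (h₁ : f₁ ∈ S) (h₂ : f₂ ∈ S) (h₃ : f₃ ∈ S) (h₁₂ : f₁ 0 < f₂ 0)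
    (h₂₃ : f₂ 0 < f₃ 0) {w : List Letter} (hw : Records f₁ f₂ f₃ w) : w ∈ signatures k := by
  classical
  have ne : ∀ {f g : Path01}, f 0 < g 0 → f ≠ g := fun h e => by simp [e] at h
  have hcard : ({f₁, f₂, f₃} : Finset Path01).card = 3 :=
    Finset.card_eq_three.2 ⟨_, _, _, ne h₁₂, ne (h₁₂.trans h₂₃), ne h₂₃, rfl⟩
  have hsub : ({f₁, f₂, f₃} : Finset Path01) ⊆ S := by
    intro f hf
    simp only [Finset.mem_insert, Finset.mem_singleton] at hf
    rcases hf with rfl | rfl | rfl <;> assumption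
  exact ⟨_, hS.mono hsub hcard.ge, hcard, fun f hf g hg => hk f (hsub hf) g (hsub hg),
    f₁, f₂, f₃, by simp, h₁₂, h₂₃, hw⟩

lemma finite_letter : Finite Letter :=
  Finite.of_injective (fun l : Letter => match l with | .x => (0 : Fin 3) | .y => 1 | .z => 2)
    fun a b h => by cases a <;> cases b <;> simp_all

theorem finite_signatures (k : ℕ) : (signatures k).Finite := by
  have := finite_letter
  refine (List.finite_length_le Letter (k + k + k)).subset ?_
  rintro w ⟨S, hS, -, hk, f₁, f₂, f₃, hSe, h₁₂, h₂₃, τ, hτ, hw⟩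
  have ne : ∀ {f g : Path01}, f 0 < g 0 → f ≠ g := fun h e => by simp [e] at h
  have mem : ∀ f, f = f₁ ∨ f = f₂ ∨ f = f₃ → f ∈ S := fun f hf => by
    rw [← Finset.mem_coe, hSe]; simpa using hf
  have m₁ := mem f₁ (by simp)
  have m₂ := mem f₂ (by simp)
  have m₃ := mem f₃ (by simp)
  have hsub : Set.range τ ⊆ (meet f₁ f₂ ∪ meet f₁ f₃) ∪ meet f₂ f₃ := by
    rintro _ ⟨i, rfl⟩
    have := (hw (w.get i) (τ i)).2 ⟨i, rfl, rfl⟩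
    revert this
    cases w.get i
    exacts [fun h => Or.inl (Or.inl h), fun h => Or.inl (Or.inr h), fun h => Or.inr h]
  have hfin : ((meet f₁ f₂ ∪ meet f₁ f₃) ∪ meet f₂ f₃).Finite :=
    ((hS.finite_meet _ m₁ _ m₂ (ne h₁₂)).union
      (hS.finite_meet _ m₁ _ m₃ (ne (h₁₂.trans h₂₃)))).union (hS.finite_meet _ m₂ _ m₃ (ne h₂₃))
  have e₁ : (Set.range τ).ncard = w.length := by
    rw [← Nat.card_coe_set_eq, Nat.card_range_of_injective hτ.injective, Nat.card_fin]
  have e₂ := Set.ncard_le_ncard hsub hfin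
  have e₃ := Set.ncard_union_le (meet f₁ f₂ ∪ meet f₁ f₃) (meet f₂ f₃)
  have e₄ := Set.ncard_union_le (meet f₁ f₂) (meet f₁ f₃)
  have e₅ := (hk _ m₁ _ m₂ (ne h₁₂)).2
  have e₆ := (hk _ m₁ _ m₃ (ne (h₁₂.trans h₂₃))).2
  have e₇ := (hk _ m₂ _ m₃ (ne h₂₃)).2
  change w.length ≤ k + k + k
  omega

/-- The increasing enumeration of a three-element set is unique. -/
lemma eq_of_insert_eq {V : Type*} [LinearOrder V] {a b d a' b' d' : V} (hab : a < b) (hbd : b < d)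
    (hab' : a' < b') (hbd' : b' < d') (h : ({a, b, d} : Finset V) = {a', b', d'}) :
    a = a' ∧ b = b' ∧ d = d' := by
  have m₁ : ∀ v ∈ ({a, b, d} : Finset V), v = a' ∨ v = b' ∨ v = d' := fun v hv => by
    rw [h] at hv; simpa using hv
  have m₂ : ∀ v ∈ ({a', b', d'} : Finset V), v = a ∨ v = b ∨ v = d := fun v hv => by
    rw [← h] at hv; simpa using hv
  simp only [Finset.mem_insert, Finset.mem_singleton, forall_eq_or_imp, forall_eq] at m₁ m₂
  grind

/-- Ramsey's theorem applied to the signatures of the triples of a system. -/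
lemma exists_uniform {k n R : ℕ} (hR : RamseyTriples n (signatures k).ncard R)
    {S : Finset Path01} (hS : IsSystem S) (hk : IsCrossing k S) (hRS : R ≤ S.card) :
    ∃ (P : Fin n → Path01) (w : List Letter), (∀ i, P i ∈ S) ∧ StrictMono (fun i => P i 0) ∧
      ∀ a b d, a < b → b < d → Records (P a) (P b) (P d) w := by
  obtain ⟨P, hP, hPS⟩ := hS.exists_listing
  have hmem : ∀ i, P i ∈ S := fun i => Finset.mem_coe.1 (hPS ▸ Set.mem_range_self i)
  choose a b d hab hbd hT using fun T : {T : Finset (Fin S.card) // T.card = 3} =>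
    exists_lt_lt_of_card_eq_three T.2
  choose w hw using fun T => hS.exists_records (hmem (a T)) (hmem (b T)) (hmem (d T))
    (hP (hab T)) (hP (hbd T))
  have : Finite (signatures k) := finite_signatures k
  let e := Finite.equivFinOfCardEq (Nat.card_coe_set_eq (signatures k))
  obtain ⟨A, hA, j, hj⟩ := hR S.card hRS fun T => e ⟨w T,
    mem_signatures hS hk (hmem _) (hmem _) (hmem _) (hP (hab T)) (hP (hbd T)) (hw T)⟩
  obtain ⟨A', hA', hcard⟩ := Finset.exists_subset_card_eq hA
  let σ := A'.orderEmbOfFin hcard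
  refine ⟨fun i => P (σ i), (e.symm j).1, fun i => hmem _, hP.comp σ.strictMono, ?_⟩
  intro a' b' d' hab' hbd'
  let T : {T : Finset (Fin S.card) // T.card = 3} := ⟨{σ a', σ b', σ d'},
    Finset.card_eq_three.2 ⟨_, _, _, (σ.strictMono hab').ne,
      (σ.strictMono (hab'.trans hbd')).ne, (σ.strictMono hbd').ne, rfl⟩⟩
  have hσ : ∀ i, σ i ∈ A := fun i => hA' (Finset.orderEmbOfFin_mem A' hcard i)
  have hTj := hj T (by
    intro v hv
    simp only [T, Finset.mem_insert, Finset.mem_singleton] at hv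
    rcases hv with rfl | rfl | rfl <;> exact hσ _)
  have hwT : w T = (e.symm j).1 := by rw [← hTj]; simp
  have hset : ({σ a', σ b', σ d'} : Finset (Fin S.card)) = {a T, b T, d T} := hT T
  have h₁ := σ.strictMono hab'
  have h₂ := σ.strictMono hbd'
  have q := eq_of_insert_eq h₁ h₂ (hab T) (hbd T) hset
  change Records (P (σ a')) (P (σ b')) (P (σ d')) _
  rw [q.1, q.2.1, q.2.2, ← hwT]
  exact hw T

/-! ### Systems all of whose triples have the same signature -/

open Classical in
/-- The finite set of abscissae where two paths meet. -/
noncomputable def meetFinset (f g : Path01) : Finset unitInterval :=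
  if h : (meet f g).Finite then h.toFinset else ∅

lemma coe_meetFinset {f g : Path01} (h : (meet f g).Finite) :
    (meetFinset f g : Set unitInterval) = meet f g := by
  simp [meetFinset, h]

lemma mem_meetFinset {f g : Path01} (h : (meet f g).Finite) (t : unitInterval) :
    t ∈ meetFinset f g ↔ f t = g t := by
  rw [← Finset.mem_coe, coe_meetFinset h]; rfl

lemma meetFinset_comm (f g : Path01) : meetFinset f g = meetFinset g f := by
  ext t
  by_cases h : (meet f g).Finite
  · rw [mem_meetFinset h, mem_meetFinset (meet_comm f g ▸ h), eq_comm]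
  · simp [meetFinset, h, show ¬ (meet g f).Finite from meet_comm f g ▸ h]

open Classical in
/-- A list of at least four paths of a system, ordered by left endpoints, whose triples all have the
same signature, gives rise to a regular family. The number of crossings is the same for all pairs
because every pair belongs to a triple, and the pairs `{0, 2}` and `{1, 2}` each stand for two
different letters. -/
theorem exists_regularFamily {n k : ℕ} {S : Finset Path01} (hS : IsSystem S)
    (hk : IsCrossing k S) {P : Fin n → Path01} {w : List Letter} (hPS : ∀ i, P i ∈ S)
    (hP : StrictMono fun i => P i 0)
    (hw : ∀ a b d, a < b → b < d → Records (P a) (P b) (P d) w) (hn : 4 ≤ n) :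
    ∃ m ≤ k, (∀ a b, a ≠ b → (meetFinset (P a) (P b)).card = m) ∧
      RegularFamily m fun a b => nthPoint (meetFinset (P a) (P b)) := by
  have hne : ∀ {a b : Fin n}, a ≠ b → P a ≠ P b := fun hab h =>
    hab (hP.injective (by simp [h]))
  have hfin : ∀ {a b : Fin n}, a ≠ b → (meet (P a) (P b)).Finite := fun hab =>
    hS.finite_meet _ (hPS _) _ (hPS _) (hne hab)
  let W : Letter → Finset (Fin w.length) := fun l => Finset.univ.filter fun i => w.get i = l
  have hmap : ∀ a b d, a < b → b < d → ∃ τ : Fin w.length ↪o unitInterval, ∀ l,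
      letterSeq (fun a b => nthPoint (meetFinset (P a) (P b))) a b d l =
        nthPoint ((W l).map τ.toEmbedding) ∧
      (W l).card = (match l with
        | Letter.x => meetFinset (P a) (P b)
        | Letter.y => meetFinset (P a) (P d)
        | Letter.z => meetFinset (P b) (P d)).card := by
    intro a b d hab hbd
    obtain ⟨τ, hτ, h⟩ := hw a b d hab hbd
    refine ⟨OrderEmbedding.ofStrictMono τ hτ, fun l => ?_⟩
    have e : ∀ f g : Path01, (meet f g).Finite → meet f g = letterMeet (P a) (P b) (P d) l →
        meetFinset f g = (W l).map (OrderEmbedding.ofStrictMono τ hτ).toEmbedding := by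
      intro f g hf hfg
      ext t
      rw [← Finset.mem_coe, coe_meetFinset hf, hfg, h l t]
      simp [W, and_comm]
    cases l
    · have := e _ _ (hfin hab.ne) rfl
      exact ⟨congrArg nthPoint this, by simp [this]⟩
    · have := e _ _ (hfin (hab.trans hbd).ne) rfl
      exact ⟨congrArg nthPoint this, by simp [this]⟩
    · have := e _ _ (hfin hbd.ne) rfl
      exact ⟨congrArg nthPoint this, by simp [this]⟩
  have cx : ∀ a b d, a < b → b < d → (W Letter.x).card = (meetFinset (P a) (P b)).card :=
    fun a b d hab hbd => ((hmap a b d hab hbd).choose_spec Letter.x).2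
  have cy : ∀ a b d, a < b → b < d → (W Letter.y).card = (meetFinset (P a) (P d)).card :=
    fun a b d hab hbd => ((hmap a b d hab hbd).choose_spec Letter.y).2
  have cz : ∀ a b d, a < b → b < d → (W Letter.z).card = (meetFinset (P b) (P d)).card :=
    fun a b d hab hbd => ((hmap a b d hab hbd).choose_spec Letter.z).2
  let v : Fin 4 → Fin n := Fin.castLE hn
  have v₀ : v 0 < v 1 := by simp [v, Fin.lt_def]
  have v₁ : v 1 < v 2 := by simp [v, Fin.lt_def]
  have v₂ : v 2 < v 3 := by simp [v, Fin.lt_def]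
  have hxy : (W Letter.x).card = (W Letter.y).card :=
    (cx _ _ _ (v₀.trans v₁) v₂).trans (cy _ _ _ v₀ v₁).symm
  have hxz : (W Letter.x).card = (W Letter.z).card :=
    (cx _ _ _ v₁ v₂).trans (cz _ _ _ v₀ v₁).symm
  have hcard : ∀ a b, a < b → (meetFinset (P a) (P b)).card = (W Letter.x).card := by
    intro a b hab
    have hthird : ∃ d, d ≠ a ∧ d ≠ b := by
      obtain ⟨d, hd⟩ := Finset.exists_mem_notMem_of_card_lt_card (s := {a, b})
        (t := (Finset.univ : Finset (Fin n)))
        (Finset.card_le_two.trans_lt (by rw [Finset.card_fin]; omega))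
      exact ⟨d, by simpa using hd⟩
    obtain ⟨d, hda, hdb⟩ := hthird
    rcases lt_or_gt_of_ne hda with h | h
    · exact (cz d a b h hab).symm.trans hxz.symm
    rcases lt_or_gt_of_ne hdb with h' | h'
    · exact (cy a d b h h').symm.trans hxy.symm
    · exact (cx a b d hab h').symm
  have hcard' : ∀ a b, a ≠ b → (meetFinset (P a) (P b)).card = (W Letter.x).card := by
    intro a b hab
    rcases lt_or_gt_of_ne hab with h | h
    · exact hcard a b h
    · rw [meetFinset_comm]; exact hcard b a h
  refine ⟨(W Letter.x).card, ?_, hcard', ?_⟩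
  · have := (hk _ (hPS _) _ (hPS _) (hne v₀.ne)).2
    rwa [← coe_meetFinset (hfin v₀.ne), Set.ncard_coe_finset, hcard _ _ v₀] at this
  have hend : ∀ a b, a ≠ b → ∀ t : unitInterval, t ∈ meetFinset (P a) (P b) →
      (t : ℝ) ∈ Set.Ioo (0 : ℝ) 1 := by
    intro a b hab t ht
    rw [mem_meetFinset (hfin hab)] at ht
    refine ⟨lt_of_le_of_ne t.2.1 fun h => ?_, lt_of_le_of_ne t.2.2 fun h => ?_⟩
    · obtain rfl : t = 0 := Subtype.ext h.symm
      exact hS.left_ne _ (hPS a) _ (hPS b) (hne hab) ht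
    · obtain rfl : t = 1 := Subtype.ext h
      exact hS.right_ne _ (hPS a) _ (hPS b) (hne hab) ht
  have hpt : ∀ a b, a ≠ b → ∀ i, 1 ≤ i → i ≤ (W Letter.x).card →
      ∃ t : unitInterval, P a t = P b t ∧ nthPoint (meetFinset (P a) (P b)) i = t := by
    intro a b hab i h₁ h₂
    obtain ⟨t, ht, hti⟩ := exists_mem_eq_nthPoint (F := meetFinset (P a) (P b)) h₁
      (by rwa [hcard' a b hab])
    exact ⟨t, (mem_meetFinset (hfin hab) t).1 ht, hti⟩
  exact {
    symm := fun a b => by rw [meetFinset_comm]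
    zero := fun a b _ => nthPoint_zero _
    last := fun a b hab => by rw [← hcard' a b hab]; exact nthPoint_last _
    lt_succ := fun a b hab i hi => nthPoint_lt_succ _ (by rwa [hcard' a b hab])
    mem_Ioo := fun a b hab i h₁ h₂ => by
      obtain ⟨t, ht, hti⟩ := hpt a b hab i h₁ h₂
      rw [hti]
      exact hend a b hab t ((mem_meetFinset (hfin hab) t).2 ht)
    regular := fun a b d a' b' d' hab hbd hab' hbd' l l' i j h => by
      obtain ⟨τ, hτ⟩ := hmap a b d hab hbd
      obtain ⟨τ', hτ'⟩ := hmap a' b' d' hab' hbd'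
      rw [(hτ l).1, (hτ l').1] at h
      rw [(hτ' l).1, (hτ' l').1]
      exact nthPoint_map_lt h
    ne := by
      intro a b d hab hbd l l' hl i j hi hi' hj hj' h
      have had := hab.trans hbd
      have hpt' : ∀ l i, 1 ≤ i → i ≤ (W Letter.x).card → ∃ t : unitInterval,
          t ∈ letterMeet (P a) (P b) (P d) l ∧
          letterSeq (fun a b => nthPoint (meetFinset (P a) (P b))) a b d l i = t := by
        intro l
        cases l
        exacts [hpt a b hab.ne, hpt a d had.ne, hpt b d hbd.ne]
      obtain ⟨t, ht, hti⟩ := hpt' l i hi hi'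
      obtain ⟨s, hs, hsj⟩ := hpt' l' j hj hj'
      obtain rfl : t = s := Subtype.ext (hti.symm.trans (h.trans hsj))
      apply hS.no_triple _ (hPS a) _ (hPS b) _ (hPS d) (hne hab.ne) (hne had.ne) (hne hbd.ne) t
      simp only [letterMeet, meet] at ht hs
      cases l <;> cases l' <;> first | exact absurd rfl hl | skip
      all_goals
        simp only [Set.mem_ofPred_eq] at ht hs
        grind }

/-- `AboveAt` has its intended meaning for points of the unit interval. -/
lemma aboveAt_iff {n m : ℕ} {S : Finset Path01} (hS : IsSystem S) {P : Fin n → Path01}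
    (hPS : ∀ i, P i ∈ S) (hP : StrictMono fun i => P i 0)
    (hm : ∀ a b, a ≠ b → (meetFinset (P a) (P b)).card = m) {p q : Fin n} (hpq : p ≠ q)
    (t : unitInterval) :
    AboveAt m (fun a b => nthPoint (meetFinset (P a) (P b))) p q t ↔ P q t < P p t := by
  have hne : ∀ {a b : Fin n}, a ≠ b → P a ≠ P b := fun hab h =>
    hab (hP.injective (by simp [h]))
  have hfin : ∀ {a b : Fin n}, a ≠ b → (meet (P a) (P b)).Finite := fun hab =>
    hS.finite_meet _ (hPS _) _ (hPS _) (hne hab)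
  have key : ∀ a b : Fin n, a < b → ∀ i ≤ m, nthPoint (meetFinset (P a) (P b)) i < t →
      t < nthPoint (meetFinset (P a) (P b)) (i + 1) →
      (Even i → P a t < P b t) ∧ (Odd i → P b t < P a t) := fun a b hab i hi h₁ h₂ =>
    lt_of_nthPoint (hP hab) (coe_meetFinset (hfin hab.ne))
      (hS.crossAt _ (hPS a) _ (hPS b) (hne hab.ne)) i (by rwa [hm a b hab.ne]) t h₁ h₂
  constructor
  · rintro ⟨i, hi, ho, he, h₁, h₂⟩
    rcases lt_or_gt_of_ne hpq with h | h
    · exact (key p q h i hi h₁ h₂).2 (ho h)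
    · simp only [meetFinset_comm (P p)] at h₁ h₂
      exact (key q p h i hi h₁ h₂).1 (he h)
  · intro ht
    obtain ⟨i, hi, h₁, h₂⟩ := exists_nthPoint_lt_lt (F := meetFinset (P p) (P q)) (u := t)
      (fun h => ht.ne' ((mem_meetFinset (hfin hpq) t).1 h))
    rw [hm p q hpq] at hi
    refine ⟨i, hi, fun h => ?_, fun h => ?_, h₁, h₂⟩
    · by_contra ho
      exact ((key p q h i hi h₁ h₂).1 (Nat.not_odd_iff_even.1 ho)).not_gt ht
    · by_contra he
      simp only [meetFinset_comm (P p)] at h₁ h₂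
      exact ((key q p h i hi h₁ h₂).2 (Nat.not_even_iff_odd.1 he)).not_gt ht

/-- If every subsystem of size `s` is upper convex then each of the listed paths is somewhere above
any `s - 1` other ones. -/
lemma exists_aboveAt_of_everySub {n m s : ℕ} {S : Finset Path01} (hS : IsSystem S)
    {P : Fin n → Path01} (hPS : ∀ i, P i ∈ S) (hP : StrictMono fun i => P i 0)
    (hm : ∀ a b, a ≠ b → (meetFinset (P a) (P b)).card = m) (hs : EverySubUpperConvex (s + 1) S)
    (hsS : s + 1 ≤ S.card) (p : Fin n) (Q : Finset (Fin n)) (hQ : Q.card ≤ s) (hpQ : p ∉ Q) :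
    ∃ t, ∀ q ∈ Q, AboveAt m (fun a b => nthPoint (meetFinset (P a) (P b))) p q t := by
  classical
  obtain ⟨T, hT, hTS, hcard⟩ := Finset.exists_subsuperset_card_eq
    (s := (insert p Q).image P) (t := S) (n := s + 1)
    (Finset.image_subset_iff.2 fun i _ => hPS i)
    (Finset.card_image_le.trans ((Finset.card_insert_le _ _).trans (by omega))) hsS
  obtain ⟨t, ht⟩ := hs T hTS hcard (P p) (hT (by simp))
  have hinj : Function.Injective P := fun a b h => hP.injective (by simp [h])
  refine ⟨t, fun q hq => ?_⟩
  have hpq : p ≠ q := by rintro rfl; exact hpQ hq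
  rw [aboveAt_iff hS hPS hP hm hpq]
  exact ht _ (hT (Finset.mem_image_of_mem _ (by simp [hq]))) (hinj.ne hpq.symm)

/-- A uniform list of paths for which suitable intervals overlap is upper convex. -/
lemma hasUpperConvexSub_of_overlap {n m : ℕ} {S : Finset Path01} (hS : IsSystem S)
    {P : Fin n → Path01} (hPS : ∀ i, P i ∈ S) (hP : StrictMono fun i => P i 0)
    (hm : ∀ a b, a ≠ b → (meetFinset (P a) (P b)).card = m) (hn : 2 ≤ n)
    (hc : RegularFamily m fun a b => nthPoint (meetFinset (P a) (P b)))
    (h : ∃ i l, Odd i ∧ i ≤ m ∧ Even l ∧ l ≤ m ∧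
      Overlap (fun a b => nthPoint (meetFinset (P a) (P b))) Letter.x i Letter.y i ∧
      Overlap (fun a b => nthPoint (meetFinset (P a) (P b))) Letter.y l Letter.z l ∧
      Overlap (fun a b => nthPoint (meetFinset (P a) (P b))) Letter.x l Letter.z i) :
    HasUpperConvexSub n S := by
  classical
  obtain ⟨i, l, hi, him, hl, hlm, hA, hB, hX⟩ := h
  have : Nontrivial (Fin n) := Fin.nontrivial_iff_two_le.2 hn
  have hinj : Function.Injective P := fun a b h => hP.injective (by simp [h])
  refine ⟨Finset.univ.image P, Finset.image_subset_iff.2 fun i _ => hPS i, ?_, ?_⟩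
  · rw [Finset.card_image_of_injective _ hinj, Finset.card_fin]
  · intro f hf
    obtain ⟨p, -, rfl⟩ := Finset.mem_image.1 hf
    obtain ⟨t, ht, h⟩ := hc.exists_aboveAt hi him hl hlm hA hB hX p
    refine ⟨⟨t, ht⟩, fun g hg hgp => ?_⟩
    obtain ⟨q, -, rfl⟩ := Finset.mem_image.1 hg
    have hpq : q ≠ p := fun e => hgp (by rw [e])
    exact (aboveAt_iff hS hPS hP hm hpq.symm ⟨t, ht⟩).1 (h q hpq)

lemma EverySubUpperConvex.hasUpperConvexSub {n s : ℕ} {S : Finset Path01}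
    (h : EverySubUpperConvex s S) (hn : n ≤ s) (hs : s ≤ S.card) : HasUpperConvexSub n S := by
  obtain ⟨T, hT, hTs⟩ := Finset.exists_subset_card_eq hs
  obtain ⟨T', hT', hTn⟩ := Finset.exists_subset_card_eq (hn.trans hTs.ge)
  refine ⟨T', hT'.trans hT, hTn, fun f hf => ?_⟩
  obtain ⟨t, ht⟩ := h T hT hTs f (hT' hf)
  exact ⟨t, fun g hg => ht g (hT' hg)⟩

/-- The three implications hold from the Ramsey number on. If `n = 4`, the last two of them are
immediate; the overlap lemmas for them need five paths. -/
theorem oneSided_of_ramseyTriples {k n R : ℕ} (hn : 4 ≤ n)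
    (hR : RamseyTriples n (signatures k).ncard R) (hR5 : 5 ≤ k → 5 ≤ R) :
    OneSided k n R := by
  intro S hS hk hRS
  obtain ⟨P, w, hPS, hP, hw⟩ := exists_uniform hR hS hk hRS
  obtain ⟨m, hmk, hm, hc⟩ := exists_regularFamily hS hk hPS hP hw hn
  have hnS : n ≤ S.card := by
    have hinj : Function.Injective P := fun a b h => hP.injective (by simp [h])
    simpa using Finset.card_le_card_of_injOn (s := Finset.univ) (t := S) P
      (fun i _ => hPS i) hinj.injOn
  let v : Fin 4 → Fin n := Fin.castLE hn
  have v₀ : v 0 < v 1 := by simp [v, Fin.lt_def]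
  have v₁ : v 1 < v 2 := by simp [v, Fin.lt_def]
  have five : 4 < n → ∃ v₀ v₁ v₂ v₃ v₄ : Fin n, v₀ < v₁ ∧ v₁ < v₂ ∧ v₂ < v₃ ∧ v₃ < v₄ :=
    fun h => ⟨⟨0, by omega⟩, ⟨1, by omega⟩, ⟨2, by omega⟩, ⟨3, by omega⟩, ⟨4, h⟩, by simp⟩
  refine ⟨fun hk2 h => ?_, fun hk4 h => ?_, fun hk5 h => ?_⟩
  · exact hasUpperConvexSub_of_overlap hS hPS hP hm (by omega) hc
      (hc.exists_overlap_of_two v₀ v₁ (hmk.trans hk2)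
        (exists_aboveAt_of_everySub hS hPS hP hm h (by omega)))
  · rcases hn.eq_or_lt with rfl | hn
    · exact h.hasUpperConvexSub le_rfl hnS
    obtain ⟨v₀, v₁, v₂, v₃, v₄, h₀, h₁, h₂, h₃⟩ := five hn
    exact hasUpperConvexSub_of_overlap hS hPS hP hm (by omega) hc
      (hc.exists_overlap_of_three h₀ h₁ h₂ h₃ (hmk.trans hk4)
        (exists_aboveAt_of_everySub hS hPS hP hm h (by omega)))
  · rcases hn.eq_or_lt with rfl | hn
    · exact h.hasUpperConvexSub (by omega) ((hR5 hk5).trans hRS)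
    obtain ⟨v₀, v₁, v₂, v₃, v₄, h₀, h₁, h₂, h₃⟩ := five hn
    exact hasUpperConvexSub_of_overlap hS hPS hP hm (by omega) hc
      (hc.exists_overlap_of_four h₀ h₁ h₂ h₃
        (exists_aboveAt_of_everySub hS hPS hP hm h (by omega)))

/-! ### Two different signatures -/

/-- The paths `f` and `g` start and end in opposite order and meet once, at `t`. -/
structure CrossOnce (f g : Path01) (t : unitInterval) : Prop where
  left_lt : f 0 < g 0
  right_lt : g 1 < f 1
  meet_eq : meet f g = {t}
  crossAt : CrossAt f g t

lemma CrossAt.symm {f g : Path01} {t : unitInterval} (h : CrossAt f g t) : CrossAt g f t :=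
  Or.symm h

/-- The straight segment with left endpoint at height `a` and slope `b`. -/
def segment (a b : ℝ) : Path01 := ⟨fun t => a + b * t, by fun_prop⟩

@[simp] lemma segment_apply (a b : ℝ) (t : unitInterval) : segment a b t = a + b * t := rfl

lemma crossOnce_segment {a b a' b' : ℝ} {t : unitInterval} (h : a < a') (h' : b' < b)
    (ht : a + b * t = a' + b' * t) (ht₁ : (t : ℝ) < 1) :
    CrossOnce (segment a b) (segment a' b') t where
  left_lt := by simpa using h
  right_lt := by
    have h1 : ((1 : unitInterval) : ℝ) = 1 := rfl
    simp only [segment_apply, h1]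
    nlinarith [mul_pos (sub_pos.2 h') (sub_pos.2 ht₁)]
  meet_eq := by
    ext s
    simp only [meet, Set.mem_ofPred_eq, segment_apply, Set.mem_singleton_iff]
    refine ⟨fun hs => Subtype.ext ?_, fun hs => hs ▸ ht⟩
    have : (b - b') * ((s : ℝ) - t) = 0 := by linarith
    rcases mul_eq_zero.1 this with h | h <;> linarith
  crossAt := by
    refine Or.inl ⟨?_, ?_⟩
    · filter_upwards [self_mem_nhdsWithin] with s hs
      have hs' : (s : ℝ) < t := hs
      simp only [segment_apply]
      nlinarith
    · filter_upwards [self_mem_nhdsWithin] with s hs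
      have hs' : (t : ℝ) < s := hs
      simp only [segment_apply]
      nlinarith

/-- Three paths crossing pairwise once, not all at the same point, realise every signature which
records these crossings. -/
lemma mem_signatures_of_crossOnce {k : ℕ} (hk : 1 ≤ k) {f₁ f₂ f₃ : Path01}
    {t₁₂ t₁₃ t₂₃ : unitInterval} (h₁₂ : CrossOnce f₁ f₂ t₁₂) (h₁₃ : CrossOnce f₁ f₃ t₁₃)
    (h₂₃ : CrossOnce f₂ f₃ t₂₃) (hne : t₁₂ ≠ t₂₃) {w : List Letter} (hw : Records f₁ f₂ f₃ w) :
    w ∈ signatures k := by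
  classical
  have ne : ∀ {f g : Path01} {t}, CrossOnce f g t → f ≠ g := fun h e => by
    have := h.left_lt
    simp [e] at this
  have pair : ∀ f ∈ ({f₁, f₂, f₃} : Finset Path01), ∀ g ∈ ({f₁, f₂, f₃} : Finset Path01), f ≠ g →
      ∃ t, CrossOnce f g t ∨ CrossOnce g f t := by
    intro f hf g hg hfg
    simp only [Finset.mem_insert, Finset.mem_singleton] at hf hg
    rcases hf with rfl | rfl | rfl <;> rcases hg with rfl | rfl | rfl
    exacts [absurd rfl hfg, ⟨_, Or.inl h₁₂⟩, ⟨_, Or.inl h₁₃⟩, ⟨_, Or.inr h₁₂⟩, absurd rfl hfg,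
      ⟨_, Or.inl h₂₃⟩, ⟨_, Or.inr h₁₃⟩, ⟨_, Or.inr h₂₃⟩, absurd rfl hfg]
  have pair' : ∀ f ∈ ({f₁, f₂, f₃} : Finset Path01), ∀ g ∈ ({f₁, f₂, f₃} : Finset Path01),
      f ≠ g → ∃ t, meet f g = {t} := by
    intro f hf g hg hfg
    obtain ⟨t, h | h⟩ := pair f hf g hg hfg
    exacts [⟨t, h.meet_eq⟩, ⟨t, meet_comm f g ▸ h.meet_eq⟩]
  have hcard : ({f₁, f₂, f₃} : Finset Path01).card = 3 :=
    Finset.card_eq_three.2 ⟨_, _, _, ne h₁₂, ne h₁₃, ne h₂₃, rfl⟩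
  have hS : IsSystem {f₁, f₂, f₃} :=
    { three_le_card := hcard.ge
      left_ne := fun f hf g hg hfg => by
        obtain ⟨t, h | h⟩ := pair f hf g hg hfg
        exacts [h.left_lt.ne, h.left_lt.ne']
      right_ne := fun f hf g hg hfg => by
        obtain ⟨t, h | h⟩ := pair f hf g hg hfg
        exacts [h.right_lt.ne', h.right_lt.ne]
      finite_meet := fun f hf g hg hfg => by
        obtain ⟨t, h⟩ := pair' f hf g hg hfg
        rw [h]
        exact Set.finite_singleton t
      crossAt := fun f hf g hg hfg s hs => by
        obtain ⟨t, h | h⟩ := pair f hf g hg hfg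
        · rw [h.meet_eq] at hs
          exact Set.mem_singleton_iff.1 hs ▸ h.crossAt
        · rw [meet_comm, h.meet_eq] at hs
          exact Set.mem_singleton_iff.1 hs ▸ h.crossAt.symm
      no_triple := by
        have main : ∀ t, f₁ t = f₂ t → f₂ t ≠ f₃ t := fun t h h' => by
          have e₁ : t ∈ meet f₁ f₂ := h
          have e₂ : t ∈ meet f₂ f₃ := h'
          rw [h₁₂.meet_eq] at e₁
          rw [h₂₃.meet_eq] at e₂
          exact hne (e₁.symm.trans e₂)
        intro f hf g hg h hh hfg hfh hgh t ht
        simp only [Finset.mem_insert, Finset.mem_singleton] at hf hg hh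
        have := main t
        rcases hf with rfl | rfl | rfl <;> rcases hg with rfl | rfl | rfl <;>
          rcases hh with rfl | rfl | rfl <;> grind }
  refine mem_signatures hS (fun f hf g hg hfg => ?_) (by simp) (by simp) (by simp) h₁₂.left_lt
    h₂₃.left_lt hw
  obtain ⟨t, h⟩ := pair' f hf g hg hfg
  rw [h, Set.ncard_singleton]
  exact ⟨le_rfl, hk⟩

/-- Three lines can cross pairwise in the order `x`, `y`, `z` and in the opposite one. -/
lemma two_le_ncard_signatures {k : ℕ} (hk : 1 ≤ k) : 2 ≤ (signatures k).ncard := by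
  have h₁ : [Letter.x, Letter.y, Letter.z] ∈ signatures k := by
    have c₁₂ : CrossOnce (segment 0 12) (segment 3 0) ⟨1 / 4, by norm_num, by norm_num⟩ :=
      crossOnce_segment (by norm_num) (by norm_num) (by norm_num) (by norm_num)
    have c₁₃ : CrossOnce (segment 0 12) (segment 8 (-8)) ⟨2 / 5, by norm_num, by norm_num⟩ :=
      crossOnce_segment (by norm_num) (by norm_num) (by norm_num) (by norm_num)
    have c₂₃ : CrossOnce (segment 3 0) (segment 8 (-8)) ⟨5 / 8, by norm_num, by norm_num⟩ :=
      crossOnce_segment (by norm_num) (by norm_num) (by norm_num) (by norm_num)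
    refine mem_signatures_of_crossOnce hk c₁₂ c₁₃ c₂₃ (by simp; norm_num)
      ⟨![⟨1 / 4, by norm_num, by norm_num⟩, ⟨2 / 5, by norm_num, by norm_num⟩,
        ⟨5 / 8, by norm_num, by norm_num⟩], ?_, fun l t => ?_⟩
    · refine Fin.strictMono_iff_lt_succ (n := 2) |>.2 fun i => ?_
      fin_cases i <;> simp [← Subtype.coe_lt_coe] <;> norm_num
    · change _ ↔ ∃ i : Fin 3, _
      cases l <;> simp only [letterMeet, c₁₂.meet_eq, c₁₃.meet_eq, c₂₃.meet_eq] <;>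
        simp [Fin.exists_fin_succ, eq_comm]
  have h₂ : [Letter.z, Letter.y, Letter.x] ∈ signatures k := by
    have c₁₂ : CrossOnce (segment 0 8) (segment 5 0) ⟨5 / 8, by norm_num, by norm_num⟩ :=
      crossOnce_segment (by norm_num) (by norm_num) (by norm_num) (by norm_num)
    have c₁₃ : CrossOnce (segment 0 8) (segment 8 (-12)) ⟨2 / 5, by norm_num, by norm_num⟩ :=
      crossOnce_segment (by norm_num) (by norm_num) (by norm_num) (by norm_num)
    have c₂₃ : CrossOnce (segment 5 0) (segment 8 (-12)) ⟨1 / 4, by norm_num, by norm_num⟩ :=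
      crossOnce_segment (by norm_num) (by norm_num) (by norm_num) (by norm_num)
    refine mem_signatures_of_crossOnce hk c₁₂ c₁₃ c₂₃ (by simp; norm_num)
      ⟨![⟨1 / 4, by norm_num, by norm_num⟩, ⟨2 / 5, by norm_num, by norm_num⟩,
        ⟨5 / 8, by norm_num, by norm_num⟩], ?_, fun l t => ?_⟩
    · refine Fin.strictMono_iff_lt_succ (n := 2) |>.2 fun i => ?_
      fin_cases i <;> simp [← Subtype.coe_lt_coe] <;> norm_num
    · change _ ↔ ∃ i : Fin 3, _
      cases l <;> simp only [letterMeet, c₁₂.meet_eq, c₁₃.meet_eq, c₂₃.meet_eq] <;>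
        simp [Fin.exists_fin_succ, eq_comm]
  rw [← Set.ncard_pair (show [Letter.x, Letter.y, Letter.z] ≠ [Letter.z, Letter.y, Letter.x] by
    simp)]
  exact Set.ncard_le_ncard (Set.insert_subset h₁ (Set.singleton_subset_iff.2 h₂))
    (finite_signatures k)

/-- With two colours available, four points do not suffice for a homogeneous set of size four. -/
lemma RamseyTriples.five_le {M R : ℕ} (hM : 2 ≤ M) {n : ℕ} (hn : 4 ≤ n)
    (h : RamseyTriples n M R) : 5 ≤ R := by
  by_contra! hR
  obtain ⟨A, hA, j, hj⟩ := h 4 (by omega)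
    fun T => if T.1 = {0, 1, 2} then ⟨0, by omega⟩ else ⟨1, by omega⟩
  have hA' : A = Finset.univ := Finset.eq_univ_of_card A
    (le_antisymm (Finset.card_le_univ A) (by simpa using hn.trans hA))
  subst hA'
  have e₁ := hj ⟨{0, 1, 2}, by decide⟩ (Finset.subset_univ _)
  have e₂ := hj ⟨{1, 2, 3}, by decide⟩ (Finset.subset_univ _)
  rw [if_pos rfl] at e₁
  rw [if_neg (by decide), ← e₁] at e₂
  simp at e₂

lemma oneSided_three (k : ℕ) : OneSided k 3 5 := fun _ _ _ hS =>
  ⟨fun _ h => h.hasUpperConvexSub le_rfl (by omega),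
    fun _ h => h.hasUpperConvexSub (by omega) (by omega),
    fun _ h => h.hasUpperConvexSub (by omega) hS⟩

end PathSystem

theorem mainTheorem2 (k n : ℕ) (hk : 1 ≤ k) (hn : 3 ≤ n) :
    (PathSystem.signatures k).Finite ∧
    ∃ U R : ℕ,
      IsLeast {U : ℕ | 0 < U ∧ PathSystem.OneSided k n U} U ∧
      IsLeast {R : ℕ | PathSystem.RamseyTriples n (PathSystem.signatures k).ncard R} R ∧
      (4 ≤ n → U ≤ R) ∧ (n = 3 → U ≤ 5) := by
  classical
  refine ⟨PathSystem.finite_signatures k, ?_⟩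
  have hM := PathSystem.two_le_ncard_signatures hk
  have hR := PathSystem.exists_ramseyTriples n (PathSystem.signatures k).ncard
  have hRs := Nat.find_spec hR
  have hUR : 4 ≤ n → 0 < Nat.find hR ∧ PathSystem.OneSided k n (Nat.find hR) := fun hn4 =>
    ⟨by have := hRs.five_le hM hn4; omega,
      PathSystem.oneSided_of_ramseyTriples hn4 hRs fun _ => hRs.five_le hM hn4⟩
  have hU3 : n = 3 → 0 < 5 ∧ PathSystem.OneSided k n 5 := fun h =>
    ⟨by norm_num, h ▸ PathSystem.oneSided_three k⟩
  have hU : ∃ U, 0 < U ∧ PathSystem.OneSided k n U := by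
    rcases hn.eq_or_lt with h | h
    · exact ⟨5, hU3 h.symm⟩
    · exact ⟨_, hUR h⟩
  exact ⟨Nat.find hU, Nat.find hR, ⟨Nat.find_spec hU, fun _ h => Nat.find_min' hU h⟩,
    ⟨hRs, fun _ h => Nat.find_min' hR h⟩, fun h => Nat.find_min' hU (hUR h),
    fun h => Nat.find_min' hU (hU3 h)⟩
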